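/- Manifolds are smooth, finite-dimensional, Hausdorff and paracompact, and $H^n(X;A)$ denotes singular cohomology. Let $M$ be a connected manifold with base point $m_0$, and let $G$ be a connected Lie group, with base point its identity; recall that $\pi_1(G)$ is commutative. (1) Evaluation of singular cocycles on loops, $[c]\mapsto([\gamma]\mapsto c(\gamma))$, is a well-defined isomorphism of groups $$\Psi\colon H^1(M;\pi_1(G))\;\xrightarrow{\ \cong\ }\;\operatorname{Hom}(\pi_1(M,m_0),\pi_1(G)).$$ It is natural: for a continuous pointed map $f\colon (M,m_0)\to(N,n_0)$ one has $\Psi_M(f^*x)=\Psi_N(x)\circ f_*$, and for a continuous homomorphism $f\colon G\to G'$ one has $\Psi_{G'}(f_*x)=f_*\circ\Psi_G(x)$. (2) Let $\pi\colon P\to M$ be a smooth principal $G$-bundle with base point $p_0$ over $m_0$, let $i\colon G\to P$ be $i(g)=p_0g$, and suppose that the universal covering group $\rho\colon\tilde G\to G$ is a double cover. A spinor structure on $P$ is a smooth principal $\tilde G$-bundle $\pi_Q\colon Q\to M$ with a smooth map $u\colon Q\to P$ such that $\pi\circ u=\pi_Q$ and $u(q\tilde g)=u(q)\rho(\tilde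 g)$; spinor structures $(Q,u)$ and $(Q',u')$ are equivalent if there is a morphism of principal $\tilde G$-bundles $a\colon Q\to Q'$ over $M$ with $u'\circ a=u$. Then $\pi_1(G)\cong\mathbb Z_2$, and for every spinor structure $(Q_0,u_0)$ on $P$ there is a bijection $\Theta$ from the set of equivalence classes of spinor structures on $P$ to $H^1(M;\mathbb Z_2)$, with $\Theta(Q_0)=0$, such that for every spinor structure $(Q,u)$ $$u_*(\pi_1(Q))=\{\,k\cdot i_*\varphi(\pi_*k)\;:\;k\in u_{0*}(\pi_1(Q_0))\,\}\subset\pi_1(P,p_0),$$ where $\varphi\colon\pi_1(M,m_0)\to\pi_1(G)$ is the homomorphism that corresponds by (1) to the image of $\Theta(Q)$ under $H^1(M;\mathbb Z_2)\cong H^1(M;\pi_1(G))$, and where $Q_0$ and $Q$ have arbitrary base points over $p_0$. -/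

import Mathlib

open scoped Manifold ContDiff

noncomputable section

namespace SpinorClassification

universe u

/-! ### Singular cohomology with coefficients in an abelian group -/

section Cohomology

variable (X : Type*) [TopologicalSpace X] {Y : Type*} [TopologicalSpace Y]
variable (A : Type*) [AddCommGroup A] {B : Type*} [AddCommGroup B]

/-- Singular `n`-simplices of `X`: continuous maps from the standard `n`-simplex to `X`. -/
abbrev SingularSimplex (n : ℕ) := C(stdSimplex ℝ (Fin (n + 1)), X)

/-- The inclusion of the face opposite to the `i`-th vertex of the standard `(n+1)`-simplex. -/
def faceMap (n : ℕ) (i : Fin (n + 2)) :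
    C(stdSimplex ℝ (Fin (n + 1)), stdSimplex ℝ (Fin (n + 2))) :=
  ⟨stdSimplex.map i.succAbove, stdSimplex.continuous_map _⟩

/-- The singular `n`-cochains with coefficients in `A`, that is, `Hom(ℤ[Sing_n X], A)`. -/
abbrev SingularCochain (n : ℕ) := SingularSimplex X n → A

/-- The singular coboundary `(δ c)(σ) = ∑ i, (-1)^i c(σ ∘ d_i)`. -/
def coboundary (n : ℕ) : SingularCochain X A n →+ SingularCochain X A (n + 1) where
  toFun c σ := ∑ i : Fin (n + 2), (-1 : ℤ) ^ (i : ℕ) • c (σ.comp (faceMap n i))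
  map_zero' := by ext σ; simp
  map_add' c c' := by ext σ; simp [Finset.sum_add_distrib]

/-- Singular `n`-cocycles. -/
def cocycles (n : ℕ) : AddSubgroup (SingularCochain X A n) := (coboundary X A n).ker

/-- Singular `n`-coboundaries. -/
def coboundaries : (n : ℕ) → AddSubgroup (SingularCochain X A n)
  | 0 => ⊥
  | n + 1 => (coboundary X A n).range

/-- The singular cohomology group `Hⁿ(X; A)`. -/
abbrev SingularCohomology (n : ℕ) :=
  cocycles X A n ⧸ (coboundaries X A n).addSubgroupOf (cocycles X A n)

variable {X A}

/-- The cohomology class of a singular cocycle. -/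
def cohomologyClass {n : ℕ} (c : cocycles X A n) : SingularCohomology X A n :=
  QuotientAddGroup.mk c

/-- The pullback of cochains along `f : X → Y`. -/
def cochainPullback (f : C(X, Y)) (n : ℕ) : SingularCochain Y A n →+ SingularCochain X A n where
  toFun c σ := c (f.comp σ)
  map_zero' := rfl
  map_add' _ _ := rfl

theorem coboundary_cochainPullback (f : C(X, Y)) (n : ℕ) (c : SingularCochain Y A n) :
    coboundary X A n (cochainPullback f n c) = cochainPullback f (n + 1) (coboundary Y A n c) :=
  rfl

/-- The homomorphism `f^* : Hⁿ(Y; A) → Hⁿ(X; A)` induced by a continuous map `f : X → Y`. -/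
def cohomologyPullback (f : C(X, Y)) (n : ℕ) :
    SingularCohomology Y A n →+ SingularCohomology X A n :=
  QuotientAddGroup.map _ _
    (((cochainPullback f n).comp (cocycles Y A n).subtype).codRestrict (cocycles X A n)
      (fun c => by
        change coboundary X A n (cochainPullback f n c) = 0
        rw [coboundary_cochainPullback, show coboundary Y A n c = 0 from c.2, map_zero]))
    (by
      rintro ⟨c, hc⟩ h
      rw [AddSubgroup.mem_comap, AddSubgroup.mem_addSubgroupOf]
      rw [AddSubgroup.mem_addSubgroupOf] at h
      change cochainPullback f n c ∈ coboundaries X A n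
      change c ∈ coboundaries Y A n at h
      cases n with
      | zero =>
        obtain rfl : c = 0 := h
        exact zero_mem _
      | succ n =>
        obtain ⟨b, rfl⟩ := h
        exact ⟨cochainPullback f n b, coboundary_cochainPullback f n b⟩)

variable (X) in
/-- The change of coefficients on cochains along `h : A → B`. -/
def cochainCoeff (h : A →+ B) (n : ℕ) : SingularCochain X A n →+ SingularCochain X B n where
  toFun c σ := h (c σ)
  map_zero' := by ext σ; simp
  map_add' _ _ := by ext σ; simp

theorem coboundary_cochainCoeff (h : A →+ B) (n : ℕ) (c : SingularCochain X A n) :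
    coboundary X B n (cochainCoeff X h n c) = cochainCoeff X h (n + 1) (coboundary X A n c) := by
  ext σ
  simp [coboundary, cochainCoeff]

variable (X) in
/-- The homomorphism `h_* : Hⁿ(X; A) → Hⁿ(X; B)` induced by a homomorphism `h : A → B`. -/
def cohomologyCoeff (h : A →+ B) (n : ℕ) :
    SingularCohomology X A n →+ SingularCohomology X B n :=
  QuotientAddGroup.map _ _
    (((cochainCoeff X h n).comp (cocycles X A n).subtype).codRestrict (cocycles X B n)
      (fun c => by
        change coboundary X B n (cochainCoeff X h n c) = 0
        rw [coboundary_cochainCoeff, show coboundary X A n c = 0 from c.2, map_zero]))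
    (by
      rintro ⟨c, hc⟩ H
      rw [AddSubgroup.mem_comap, AddSubgroup.mem_addSubgroupOf]
      rw [AddSubgroup.mem_addSubgroupOf] at H
      change cochainCoeff X h n c ∈ coboundaries X B n
      change c ∈ coboundaries X A n at H
      cases n with
      | zero =>
        obtain rfl : c = 0 := H
        rw [map_zero]
        exact zero_mem _
      | succ n =>
        obtain ⟨b, rfl⟩ := H
        exact ⟨cochainCoeff X h n b, coboundary_cochainCoeff h n b⟩)

/-- A path `γ`, viewed as a singular `1`-simplex with `0`-th vertex `γ(0)` and first vertex
`γ(1)`: the point with barycentric coordinates `(1 - t, t)` goes to `γ(t)`. -/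
def simplexOfPath {x y : X} (γ : Path x y) : SingularSimplex X 1 where
  toFun s := γ ⟨s 1, stdSimplex.zero_le s 1, stdSimplex.le_one s 1⟩
  continuous_toFun := by
    refine γ.continuous.comp (Continuous.subtype_mk ?_ _)
    exact (continuous_apply (1 : Fin 2)).comp continuous_subtype_val

end Cohomology

/-- `Ψ : H¹(X; B) ≃ Hom(π₁(X, x), B)` is the evaluation of cocycles on loops: the class of a
cocycle `c` goes to the homomorphism `[γ] ↦ c(γ)`. -/
def IsEvaluation {X : Type*} [TopologicalSpace X] {x : X} {B : Type*} [CommGroup B]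
    (Ψ : SingularCohomology X (Additive B) 1 ≃+ Additive (FundamentalGroup X x →* B)) : Prop :=
  ∀ (c : cocycles X (Additive B) 1) (γ : Path x x),
    (Ψ (cohomologyClass c)).toMul (FundamentalGroup.fromPath (Path.Homotopic.Quotient.mk γ)) =
      (c.1 (simplexOfPath γ)).toMul

/-! ### The fundamental group of a topological group is commutative -/

section PiOne

variable (G : Type*) [TopologicalSpace G] [Group G] [ContinuousMul G]

/-- The pointwise multiplication of loops (up to homotopy). -/
def pointwiseMul (a b : FundamentalGroup G (1 : G)) : FundamentalGroup G (1 : G) :=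
  FundamentalGroup.mapOfEq (⟨fun x => x.1 * x.2, continuous_mul⟩ : C(G × G, G))
    (x := ((1 : G), (1 : G))) (one_mul 1) (Path.Homotopic.prod a b)

theorem pointwiseMul_one (a : FundamentalGroup G (1 : G)) : pointwiseMul G a 1 = a := by
  induction a using Path.Homotopic.Quotient.ind with
  | _ a =>
    rw [pointwiseMul, FundamentalGroup.mapOfEq_apply, FundamentalGroup.one_def]
    refine congrArg Path.Homotopic.Quotient.mk (Path.ext (funext fun t => ?_))
    exact mul_one (a t)

theorem one_pointwiseMul (a : FundamentalGroup G (1 : G)) : pointwiseMul G 1 a = a := by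
  induction a using Path.Homotopic.Quotient.ind with
  | _ a =>
    rw [pointwiseMul, FundamentalGroup.mapOfEq_apply, FundamentalGroup.one_def]
    refine congrArg Path.Homotopic.Quotient.mk (Path.ext (funext fun t => ?_))
    exact one_mul (a t)

theorem pointwiseMul_mul (a b c d : FundamentalGroup G (1 : G)) :
    pointwiseMul G (a * b) (c * d) = pointwiseMul G a c * pointwiseMul G b d := by
  rw [pointwiseMul, pointwiseMul, pointwiseMul, ← map_mul]
  exact congrArg _ (Path.Homotopic.comp_prod_eq_prod_comp b d a c).symm

theorem fundamentalGroup_mul_comm (a b : FundamentalGroup G (1 : G)) : a * b = b * a :=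
  (EckmannHilton.mul_comm (m₁ := pointwiseMul G) (m₂ := (· * ·)) (e₁ := 1) (e₂ := 1)
    ⟨{ left_id := one_pointwiseMul G, right_id := pointwiseMul_one G }⟩
    EckmannHilton.MulOneClass.isUnital (pointwiseMul_mul G)).comm a b

/-- The fundamental group of a topological group, based at the identity, as a commutative group
(the multiplication is that of `FundamentalGroup`). -/
instance fundamentalGroupCommGroup : CommGroup (FundamentalGroup G (1 : G)) :=
  { (inferInstance : Group (FundamentalGroup G (1 : G))) with
    mul_comm := fundamentalGroup_mul_comm G }

end PiOne

/-! ### Principal bundles and spinor structures -/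

section Bundles

/-- `π : P → M` is a smooth principal `G`-bundle, where the right action of `G` on `P` is given as
an action of `Gᵐᵒᵖ`: `p · g = MulOpposite.op g • p`. -/
structure IsPrincipalBundle (EM EG EP : Type*)
    [NormedAddCommGroup EM] [NormedSpace ℝ EM] [NormedAddCommGroup EG] [NormedSpace ℝ EG]
    [NormedAddCommGroup EP] [NormedSpace ℝ EP]
    {M : Type*} [TopologicalSpace M] [ChartedSpace EM M]
    (G : Type*) [TopologicalSpace G] [ChartedSpace EG G] [Group G]
    {P : Type*} [TopologicalSpace P] [ChartedSpace EP P] [MulAction Gᵐᵒᵖ P]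
    (π : P → M) : Prop where
  contMDiff_proj : ContMDiff 𝓘(ℝ, EP) 𝓘(ℝ, EM) ∞ π
  surjective_proj : Function.Surjective π
  /-- The right action of `G` on `P` is smooth. -/
  contMDiff_action : ContMDiff (𝓘(ℝ, EP).prod 𝓘(ℝ, EG)) 𝓘(ℝ, EP) ∞
    (fun x : P × G => MulOpposite.op x.2 • x.1)
  /-- The action preserves the fibres and is transitive on each fibre. -/
  proj_eq_iff : ∀ p p' : P, π p = π p' ↔ ∃ g : G, MulOpposite.op g • p = p'
  /-- The action is free. -/
  free : ∀ (p : P) (g : G), MulOpposite.op g • p = p → g = 1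
  /-- There are smooth `G`-equivariant local trivialisations around each point of the base. -/
  exists_trivialization : ∀ m : M, ∃ e : Bundle.Trivialization G π, m ∈ e.baseSet ∧
    ContMDiffOn 𝓘(ℝ, EP) (𝓘(ℝ, EM).prod 𝓘(ℝ, EG)) ∞ e e.source ∧
    ContMDiffOn (𝓘(ℝ, EM).prod 𝓘(ℝ, EG)) 𝓘(ℝ, EP) ∞ e.toOpenPartialHomeomorph.symm e.target ∧
    ∀ p ∈ e.source, ∀ g : G, (e (MulOpposite.op g • p)).2 = (e p).2 * g

/-- `ρ : Gt → G` exhibits the (simply connected) Lie group `Gt` as the universal covering group of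
the Lie group `G`: it is a homomorphism and a smooth covering map. -/
structure IsUniversalCoveringGroup (EG : Type*) [NormedAddCommGroup EG] [NormedSpace ℝ EG]
    {G : Type*} [TopologicalSpace G] [ChartedSpace EG G] [Group G]
    {Gt : Type*} [TopologicalSpace Gt] [ChartedSpace EG Gt] [Group Gt] (ρ : Gt →* G) : Prop where
  simplyConnected : SimplyConnectedSpace Gt
  isCoveringMap : IsCoveringMap ρ
  surjective : Function.Surjective ρ
  isLocalDiffeomorph : IsLocalDiffeomorph 𝓘(ℝ, EG) 𝓘(ℝ, EG) ∞ ρ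

variable (EM EG : Type*) {EP : Type*}
  [NormedAddCommGroup EM] [NormedSpace ℝ EM] [NormedAddCommGroup EG] [NormedSpace ℝ EG]
  [NormedAddCommGroup EP] [NormedSpace ℝ EP]
  {M : Type*} [TopologicalSpace M] [ChartedSpace EM M]
  {G : Type*} [TopologicalSpace G] [ChartedSpace EG G] [Group G]
  {Gt : Type*} [TopologicalSpace Gt] [ChartedSpace EG Gt] [Group Gt]
  {P : Type u} [TopologicalSpace P] [ChartedSpace EP P] [MulAction Gᵐᵒᵖ P]

/-- A spinor structure for the principal `G`-bundle `π : P → M`, relative to the covering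
homomorphism `ρ : Gt → G`: a principal `Gt`-bundle `Q → M` with a smooth map `Q → P` over `M` which
is equivariant along `ρ`. The total space `Q` (Hausdorff and paracompact, as `P`) is modelled on the
same vector space as `P`, because the spinor map is a local diffeomorphism. -/
structure SpinorStructure (π : P → M) (ρ : Gt →* G) where
  /-- The total space. -/
  Q : Type u
  [topologicalSpace : TopologicalSpace Q]
  [chartedSpace : ChartedSpace EP Q]
  [isManifold : IsManifold 𝓘(ℝ, EP) ∞ Q]
  [t2Space : T2Space Q]
  [paracompactSpace : ParacompactSpace Q]
  [mulAction : MulAction Gtᵐᵒᵖ Q]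
  /-- The bundle projection. -/
  proj : Q → M
  isPrincipalBundle : IsPrincipalBundle EM EG EP Gt proj
  /-- The spinor map `u`. -/
  spinorMap : Q → P
  contMDiff_spinorMap : ContMDiff 𝓘(ℝ, EP) 𝓘(ℝ, EP) ∞ spinorMap
  proj_spinorMap : ∀ q, π (spinorMap q) = proj q
  spinorMap_smul : ∀ (q : Q) (g : Gt),
    spinorMap (MulOpposite.op g • q) = MulOpposite.op (ρ g) • spinorMap q

attribute [instance] SpinorStructure.topologicalSpace SpinorStructure.chartedSpace
  SpinorStructure.isManifold SpinorStructure.t2Space SpinorStructure.paracompactSpace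
  SpinorStructure.mulAction

variable {EM EG} {π : P → M} {ρ : Gt →* G}

/-- Two spinor structures are equivalent if there is a morphism of principal bundles between them
which is compatible with the spinor maps. -/
def SpinorStructure.Equivalent (S S' : SpinorStructure EM EG (EP := EP) π ρ) : Prop :=
  ∃ a : S.Q → S'.Q, ContMDiff 𝓘(ℝ, EP) 𝓘(ℝ, EP) ∞ a ∧
    (∀ q, S'.proj (a q) = S.proj q) ∧
    (∀ (q : S.Q) (g : Gt), a (MulOpposite.op g • q) = MulOpposite.op g • a q) ∧
    ∀ q, S'.spinorMap (a q) = S.spinorMap q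

/-- The image of `u_* : π₁(Q, q) → π₁(P, p)` for a point `q` over `p`. -/
def SpinorStructure.imagePiOne (S : SpinorStructure EM EG (EP := EP) π ρ) {q : S.Q} {p : P}
    (h : S.spinorMap q = p) : Subgroup (FundamentalGroup P p) :=
  (FundamentalGroup.mapOfEq (⟨S.spinorMap, S.contMDiff_spinorMap.continuous⟩ : C(S.Q, P)) h).range

/-- The homomorphism `π_* : π₁(P, p) → π₁(M, m)` induced by the projection, where `π p = m`. -/
def IsPrincipalBundle.projPiOne (hπ : IsPrincipalBundle EM EG EP G π) {p : P} {m : M}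
    (h : π p = m) : FundamentalGroup P p →* FundamentalGroup M m :=
  FundamentalGroup.mapOfEq (⟨π, hπ.contMDiff_proj.continuous⟩ : C(P, M)) h

/-- The homomorphism `i_* : π₁(G, 1) → π₁(P, p)` induced by the orbit map `i(g) = p · g`. -/
def IsPrincipalBundle.orbitPiOne (hπ : IsPrincipalBundle EM EG EP G π) (p : P) :
    FundamentalGroup G (1 : G) →* FundamentalGroup P p :=
  FundamentalGroup.mapOfEq
    (⟨fun g => MulOpposite.op g • p,
      hπ.contMDiff_action.continuous.comp (Continuous.prodMk_right p)⟩ : C(G, P))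
    (by simp)

end Bundles

end SpinorClassification

end

/-! Evaluation on loops. A 1-cocycle is additive over the faces of a 2-simplex. Cutting a homotopy
square along its diagonal gives homotopy invariance, and a degenerate triangle gives additivity
under concatenation. A cocycle that vanishes on loops is the coboundary of `x ↦ c(path from x₀ to
x)`. A homomorphism φ extends to all paths when these are closed up by chosen paths from the base
point (`transport`), and this is a cocycle because the 2-simplex is simply connected. Naturality is
visible on cocycles.

Spinor structures. The spinor map u : Q → P is a covering on which ker ρ ≅ π₁(G) acts freely and
transitively on the fibres, so it has a monodromy χ : π₁(P) → π₁(G), called `holonomy`. Its kernel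
is the image of u_* (`mem_imagePiOne_iff`), it satisfies χ ∘ i_* = id (`holonomy_orbitPiOne`), and
by the lifting criterion it determines the spinor structure up to equivalence
(`equivalent_of_holonomy_eq`).

Two monodromies χ₀ and χ agree on ker π_* (`holonomy_eq_of_projPiOne_eq_one`): the quotient of Q₀
×_P Q by the diagonal action is a covering of M, and it closes up over loops that are null-homotopic
in M. As π_* is surjective, χ / χ₀ = φ ∘ π_* for a unique φ : π₁(M) → π₁(G). Every φ occurs, since
the bundle Q₀ can be twisted by locally constant transition functions built from φ
(`exists_holonomy_eq`). Thus Q ↦ φ is a bijection on equivalence classes, and Θ is its composite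
with the inverse of evaluation. The formula for the image of u_* compares the kernels of χ and χ₀ ·
(φ ∘ π_*), where π₁(G) has order two. -/

noncomputable section

namespace SpinorClassification

/-! ### First cohomology and homomorphisms from the fundamental group. -/

section EvaluationOnLoops

/-- The affine singular simplex in the unit square with given vertices. -/
def affineSimplex {n : ℕ} (v : Fin (n + 1) → unitInterval × unitInterval) :
    SingularSimplex (unitInterval × unitInterval) n where
  toFun s :=
    (⟨∑ i, s i * ((v i).1 : ℝ), (convex_Icc (0 : ℝ) 1).sum_mem (fun i _ => s.2.1 i) s.2.2
      fun i _ => (v i).1.2⟩,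
     ⟨∑ i, s i * ((v i).2 : ℝ), (convex_Icc (0 : ℝ) 1).sum_mem (fun i _ => s.2.1 i) s.2.2
      fun i _ => (v i).2.2⟩)
  continuous_toFun := by
    have h (i : Fin (n + 1)) : Continuous fun s : stdSimplex ℝ (Fin (n + 1)) => s i :=
      (continuous_apply i).comp continuous_subtype_val
    refine Continuous.prodMk (Continuous.subtype_mk ?_ _) (Continuous.subtype_mk ?_ _) <;>
      exact continuous_finsetSum _ fun i _ => (h i).mul continuous_const

theorem sum_stdSimplexMap_mul {m n : ℕ} (f : Fin m → Fin n) (s : stdSimplex ℝ (Fin m))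
    (w : Fin n → ℝ) : ∑ j, stdSimplex.map f s j * w j = ∑ i, s i * w (f i) := by
  have h (j : Fin n) : stdSimplex.map f s j = ∑ i with f i = j, s i := by
    rw [stdSimplex.map_coe, FunOnFinite.linearMap_apply_apply]
  simp_rw [h, Finset.sum_mul]
  rw [← Finset.sum_fiberwise (s := Finset.univ) (g := f)]
  refine Finset.sum_congr rfl fun j _ => Finset.sum_congr rfl fun i hi => ?_
  rw [(Finset.mem_filter.1 hi).2]

theorem affineSimplex_comp_faceMap {n : ℕ} (v : Fin (n + 2) → unitInterval × unitInterval)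
    (i : Fin (n + 2)) :
    (affineSimplex v).comp (faceMap n i) = affineSimplex (v ∘ i.succAbove) := by
  ext s
  · exact sum_stdSimplexMap_mul i.succAbove s fun j => ((v j).1 : ℝ)
  · exact sum_stdSimplexMap_mul i.succAbove s fun j => ((v j).2 : ℝ)

variable {X : Type*} [TopologicalSpace X] {A : Type*} [AddCommGroup A]

theorem cocycle_apply_faces (c : cocycles X A 1) (s : SingularSimplex X 2) :
    c.1 (s.comp (faceMap 1 2)) + c.1 (s.comp (faceMap 1 0)) = c.1 (s.comp (faceMap 1 1)) := by
  have h : ∑ i : Fin 3, (-1 : ℤ) ^ (i : ℕ) • c.1 (s.comp (faceMap 1 i)) = 0 := congrFun c.2 s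
  simp only [Fin.sum_univ_three, Fin.val_zero, Fin.val_one, Fin.val_two, pow_zero, pow_one,
    one_smul, neg_smul, even_two, Even.neg_pow, one_pow] at h
  rw [← sub_eq_zero, ← h]
  abel

theorem cocycle_apply_triangle (c : cocycles X A 1) (F : C(unitInterval × unitInterval, X))
    (u v w : unitInterval × unitInterval) :
    c.1 (F.comp (affineSimplex ![u, v])) + c.1 (F.comp (affineSimplex ![v, w])) =
      c.1 (F.comp (affineSimplex ![u, w])) := by
  have h := cocycle_apply_faces c (F.comp (affineSimplex ![u, v, w]))
  simp only [ContinuousMap.comp_assoc, affineSimplex_comp_faceMap] at h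
  convert h using 6 <;> (funext i; fin_cases i <;> rfl)

theorem simplexOfPath_eq {x y : X} (γ : Path x y) (F : C(unitInterval × unitInterval, X))
    (u v : unitInterval × unitInterval)
    (h : ∀ t : unitInterval, ∀ z : unitInterval × unitInterval,
      (z.1 : ℝ) = (1 - t) * u.1 + t * v.1 →
      (z.2 : ℝ) = (1 - t) * u.2 + t * v.2 → F z = γ t) :
    F.comp (affineSimplex ![u, v]) = simplexOfPath γ := by
  ext s
  have hs : s 0 = 1 - s 1 := by
    have := stdSimplex.add_eq_one s
    linarith
  refine h ⟨s 1, _⟩ _ ?_ ?_ <;> simp [affineSimplex, Fin.sum_univ_two, hs]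

/-- The three faces of a constant 2-simplex coincide, so the value `a` satisfies `a + a = a`. -/
theorem cocycle_apply_const (c : cocycles X A 1) (x : X) :
    c.1 (ContinuousMap.const _ x) = 0 := by
  have h := cocycle_apply_faces c (ContinuousMap.const _ x)
  simpa only [ContinuousMap.const_comp, add_eq_left] using h

/-- The diagonal cuts the homotopy square into two triangles. Both compute the value on the
diagonal, and the two sides at the fixed endpoints are constant. -/
theorem cocycle_apply_homotopic (c : cocycles X A 1) {x y : X} {γ γ' : Path x y}
    (H : γ.Homotopic γ') : c.1 (simplexOfPath γ) = c.1 (simplexOfPath γ') := by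
  obtain ⟨F⟩ := H
  have h₁ := cocycle_apply_triangle c F.toContinuousMap (0, 0) (0, 1) (1, 1)
  have h₂ := cocycle_apply_triangle c F.toContinuousMap (0, 0) (1, 0) (1, 1)
  rw [← h₂, simplexOfPath_eq γ _ (0, 0) (0, 1), simplexOfPath_eq γ' _ (1, 0) (1, 1),
    simplexOfPath_eq (Path.refl x) _ (0, 0) (1, 0),
    simplexOfPath_eq (Path.refl y) _ (0, 1) (1, 1)] at h₁
  · have hc (z : X) : c.1 (simplexOfPath (Path.refl z)) = 0 := cocycle_apply_const c z
    rwa [hc, hc, add_zero, zero_add] at h₁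
  all_goals
    intro t ⟨z₁, z₂⟩ h h'
    simp only [Set.Icc.coe_zero, Set.Icc.coe_one, mul_zero, mul_one, add_zero, zero_add,
      sub_add_cancel] at h h'
  · obtain rfl : z₂ = 1 := Subtype.ext h'
    simp
  · obtain rfl : z₂ = 0 := Subtype.ext h'
    simp
  · obtain rfl : z₁ = 1 := Subtype.ext h
    obtain rfl : z₂ = t := Subtype.ext h'
    simp
  · obtain rfl : z₁ = 0 := Subtype.ext h
    obtain rfl : z₂ = t := Subtype.ext h'
    simp

/-- The concatenated path is made a map on the square that ignores the first coordinate, and the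
cocycle identity is applied to the collinear triangle with vertices at heights 0, 1/2 and 1. -/
theorem cocycle_apply_trans (c : cocycles X A 1) {x y z : X} (γ : Path x y) (γ' : Path y z) :
    c.1 (simplexOfPath (γ.trans γ')) = c.1 (simplexOfPath γ) + c.1 (simplexOfPath γ') := by
  let F : C(unitInterval × unitInterval, X) := ⟨fun s => (γ.trans γ') s.2, by fun_prop⟩
  have hh : (1 / 2 : ℝ) ∈ unitInterval := by constructor <;> norm_num
  have h := cocycle_apply_triangle c F (0, 0) (0, ⟨1 / 2, hh⟩) (0, 1)
  rw [simplexOfPath_eq γ _ (0, 0), simplexOfPath_eq γ', simplexOfPath_eq (γ.trans γ')] at h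
  · exact h.symm
  all_goals
    intro t ⟨z₁, z₂⟩ h h'
    simp only [Set.Icc.coe_zero, Set.Icc.coe_one, mul_zero, mul_one, add_zero, zero_add] at h h'
  · obtain rfl : z₂ = t := Subtype.ext h'
    rfl
  · change (γ.trans γ') z₂ = _
    have h₂ : (z₂ : ℝ) = (1 + t) / 2 := by linarith
    rw [Path.trans_apply]
    split_ifs with hz
    -- The second half meets the branch `z₂ ≤ 1/2` only at the midpoint.
    · have ht : (t : ℝ) = 0 := le_antisymm (by linarith) t.2.1
      obtain rfl : t = 0 := Subtype.ext ht
      simp [h₂]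
    · congr 1
      ext
      simp only [h₂]
      ring
  · change (γ.trans γ') z₂ = _
    rw [Path.trans_apply, dif_pos (by linarith [t.2.2])]
    congr 1
    ext
    simp only [h']
    ring

/-- The path from the `0`-th to the first vertex underlying a singular `1`-simplex. -/
def pathOfSimplex (s : SingularSimplex X 1) :
    Path (s (stdSimplexHomeomorphUnitInterval.symm 0))
      (s (stdSimplexHomeomorphUnitInterval.symm 1)) where
  toFun t := s (stdSimplexHomeomorphUnitInterval.symm t)
  continuous_toFun := by fun_prop
  source' := rfl
  target' := rfl

theorem simplexOfPath_pathOfSimplex (s : SingularSimplex X 1) :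
    simplexOfPath (pathOfSimplex s) = s := by
  ext t
  exact congrArg s (stdSimplexHomeomorphUnitInterval.symm_apply_apply t)

theorem pathOfSimplex_simplexOfPath_apply {x y : X} (γ : Path x y) (t : unitInterval) :
    pathOfSimplex (simplexOfPath γ) t = γ t := by
  change γ _ = γ t
  congr 1

/-- The change of endpoints of a path along equalities does not affect the value of a function
on paths. -/
theorem apply_eq_of_forall_eq {Z : Type*} (f : ∀ x y : X, Path.Homotopic.Quotient x y → Z)
    {x y x' y' : X} {γ : Path x y} {γ' : Path x' y'} (h : ∀ t, γ t = γ' t) :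
    f x y (.mk γ) = f x' y' (.mk γ') := by
  obtain rfl : x = x' := by simpa using h 0
  obtain rfl : y = y' := by simpa using h 1
  rw [Path.ext (funext h)]

variable {B : Type*} [CommGroup B] {x₀ : X}

/-- A homomorphism from the fundamental group to a commutative group, extended to all paths by
means of chosen paths from the base point. -/
def transport [PathConnectedSpace X] (φ : FundamentalGroup X x₀ →* B) (x y : X)
    (p : Path.Homotopic.Quotient x y) : B :=
  φ (FundamentalGroup.fromPath
    ((Path.Homotopic.Quotient.mk (PathConnectedSpace.somePath x₀ x)).trans
    (p.trans (Path.Homotopic.Quotient.mk (PathConnectedSpace.somePath x₀ y)).symm)))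

/-- The chosen path to `y` cancels in the middle. The product in `FundamentalGroup` concatenates in
the reverse order, which is harmless because `B` is commutative. -/
theorem transport_trans [PathConnectedSpace X] (φ : FundamentalGroup X x₀ →* B) {x y z : X}
    (p : Path.Homotopic.Quotient x y) (q : Path.Homotopic.Quotient y z) :
    transport φ x z (p.trans q) = transport φ x y p * transport φ y z q := by
  rw [transport, transport, transport, mul_comm, ← map_mul, FundamentalGroup.mul_def]
  refine congrArg φ ?_
  change _ = Path.Homotopic.Quotient.trans (Path.Homotopic.Quotient.trans _ _)
    (Path.Homotopic.Quotient.trans _ _)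
  simp only [Path.Homotopic.Quotient.trans_assoc]
  rw [← Path.Homotopic.Quotient.trans_assoc (Path.Homotopic.Quotient.symm _)]
  simp

/-- The chosen path from `x₀` to itself need not be constant. It conjugates the loop, which a
commutative target does not see. -/
theorem transport_loop [PathConnectedSpace X] (φ : FundamentalGroup X x₀ →* B)
    (p : Path.Homotopic.Quotient x₀ x₀) :
    transport φ x₀ x₀ p = φ (FundamentalGroup.fromPath p) := by
  set a : FundamentalGroup X x₀ :=
    FundamentalGroup.fromPath (.mk (PathConnectedSpace.somePath x₀ x₀)) with ha
  have h : transport φ x₀ x₀ p = φ (a⁻¹ * FundamentalGroup.fromPath p * a) := by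
    rw [transport, FundamentalGroup.mul_def, FundamentalGroup.mul_def, FundamentalGroup.inv_def]
  rw [h, map_mul, map_mul, mul_right_comm, ← map_mul, inv_mul_cancel, map_one, one_mul]

theorem cocycle_apply_symm (c : cocycles X A 1) {x y : X} (γ : Path x y) :
    c.1 (simplexOfPath γ.symm) = -c.1 (simplexOfPath γ) := by
  rw [eq_neg_iff_add_eq_zero, ← cocycle_apply_trans,
    cocycle_apply_homotopic c (Path.Homotopic.symm_trans γ)]
  exact cocycle_apply_const c y

theorem stdSimplexHomeomorphUnitInterval_symm_zero :
    stdSimplexHomeomorphUnitInterval.symm 0 = stdSimplex.vertex 0 := by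
  rw [Homeomorph.symm_apply_eq]
  exact stdSimplexHomeomorphUnitInterval_zero.symm

theorem stdSimplexHomeomorphUnitInterval_symm_one :
    stdSimplexHomeomorphUnitInterval.symm 1 = stdSimplex.vertex 1 := by
  rw [Homeomorph.symm_apply_eq]
  exact stdSimplexHomeomorphUnitInterval_one.symm

theorem faceMap_vertex (n : ℕ) (i : Fin (n + 2)) (j : Fin (n + 1)) :
    faceMap n i (stdSimplex.vertex j) = stdSimplex.vertex (i.succAbove j) :=
  stdSimplex.map_vertex _ _

/-- Injectivity of the evaluation. The primitive of `c` at a point is its value on the chosen path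
to that point; a 1-simplex together with the chosen paths to its ends forms a loop. -/
theorem cocycle_ext [PathConnectedSpace X] (x₀ : X) (c : cocycles X A 1)
    (h : ∀ γ : Path x₀ x₀, c.1 (simplexOfPath γ) = 0) : cohomologyClass c = 0 := by
  refine (QuotientAddGroup.eq_zero_iff c).2 ⟨fun s =>
    c.1 (simplexOfPath (PathConnectedSpace.somePath x₀ (s (stdSimplex.vertex 0)))), ?_⟩
  ext s
  change ∑ i : Fin 2, (-1 : ℤ) ^ (i : ℕ) • c.1 (simplexOfPath
    (PathConnectedSpace.somePath x₀ (s (faceMap 0 i (stdSimplex.vertex 0))))) = c.1 s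
  -- The face of index 0 is the end of the simplex and the face of index 1 its beginning, whence the
  -- signs.
  rw [Fin.sum_univ_two, faceMap_vertex, faceMap_vertex,
    show (0 : Fin 2).succAbove (0 : Fin 1) = 1 from rfl,
    show (1 : Fin 2).succAbove (0 : Fin 1) = 0 from rfl,
    ← stdSimplexHomeomorphUnitInterval_symm_zero, ← stdSimplexHomeomorphUnitInterval_symm_one]
  have h' := h (((PathConnectedSpace.somePath x₀ _).trans (pathOfSimplex s)).trans
    (PathConnectedSpace.somePath x₀ _).symm)
  rw [cocycle_apply_trans, cocycle_apply_trans, cocycle_apply_symm,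
    simplexOfPath_pathOfSimplex] at h'
  simp only [Fin.val_zero, Fin.val_one, pow_zero, pow_one, one_smul, neg_smul]
  rw [← sub_eq_zero, ← neg_eq_zero, ← h']
  abel

instance (n : ℕ) : SimplyConnectedSpace (stdSimplex ℝ (Fin (n + 1))) :=
  have := (convex_stdSimplex ℝ (Fin (n + 1))).contractibleSpace ⟨_, (stdSimplex.vertex 0).2⟩
  inferInstance

/-- In the simply connected 2-simplex the edge 0-1 followed by the edge 1-2 is homotopic to the edge
0-2; the singular simplex carries this homotopy to `X`. -/
theorem transport_faces [PathConnectedSpace X] (φ : FundamentalGroup X x₀ →* B)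
    (s : SingularSimplex X 2) :
    transport φ _ _ (.mk (pathOfSimplex (s.comp (faceMap 1 2)))) *
      transport φ _ _ (.mk (pathOfSimplex (s.comp (faceMap 1 0)))) =
    transport φ _ _ (.mk (pathOfSimplex (s.comp (faceMap 1 1)))) := by
  have e (i : Fin 3) : faceMap 1 i (stdSimplexHomeomorphUnitInterval.symm 0) =
      stdSimplex.vertex (i.succAbove 0) := by
    rw [stdSimplexHomeomorphUnitInterval_symm_zero, faceMap_vertex]
  have e' (i : Fin 3) : faceMap 1 i (stdSimplexHomeomorphUnitInterval.symm 1) =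
      stdSimplex.vertex (i.succAbove 1) := by
    rw [stdSimplexHomeomorphUnitInterval_symm_one, faceMap_vertex]
  let p (i a b : Fin 3) (ha : i.succAbove 0 = a) (hb : i.succAbove 1 = b) :
      Path (stdSimplex.vertex (S := ℝ) a) (stdSimplex.vertex b) :=
    (pathOfSimplex (faceMap 1 i)).cast (by rw [e, ha]) (by rw [e', hb])
  have hp (i a b : Fin 3) (ha : i.succAbove 0 = a) (hb : i.succAbove 1 = b) :
      transport φ _ _ (.mk (pathOfSimplex (s.comp (faceMap 1 i)))) =
        transport φ _ _ (.mk ((p i a b ha hb).map s.continuous)) :=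
    apply_eq_of_forall_eq (transport φ) fun t => rfl
  have h : ((p 2 0 1 rfl rfl).trans (p 0 1 2 rfl rfl)).Homotopic (p 1 0 2 rfl rfl) :=
    SimplyConnectedSpace.paths_homotopic _ _
  have h' := Path.Homotopic.Quotient.eq.2 (h.map s)
  rw [Path.map_trans, Path.Homotopic.Quotient.mk_trans] at h'
  rw [hp 2 0 1 rfl rfl, hp 0 1 2 rfl rfl, hp 1 0 2 rfl rfl, ← transport_trans, h']

theorem transport_cocycle [PathConnectedSpace X] (φ : FundamentalGroup X x₀ →* B) :
    (fun s => Additive.ofMul (transport φ _ _ (.mk (pathOfSimplex s)))) ∈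
      cocycles X (Additive B) 1 := by
  refine funext fun s => ?_
  have h := congrArg Additive.ofMul (transport_faces φ s)
  rw [ofMul_mul, ← sub_eq_zero] at h
  change ∑ i : Fin 3, (-1 : ℤ) ^ (i : ℕ) • Additive.ofMul
    (transport φ _ _ (.mk (pathOfSimplex (s.comp (faceMap 1 i))))) = 0
  simp only [Fin.sum_univ_three, Fin.val_zero, Fin.val_one, Fin.val_two, pow_zero, pow_one,
    one_smul, neg_smul, even_two, Even.neg_pow, one_pow]
  rw [← h]
  abel

variable (B x₀) in
/-- The evaluation of cocycles on loops, as a homomorphism. -/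
def cocycleEvaluation :
    cocycles X (Additive B) 1 →+ Additive (FundamentalGroup X x₀ →* B) where
  toFun c := Additive.ofMul
    { toFun := fun p => Quotient.lift (fun γ : Path x₀ x₀ => (c.1 (simplexOfPath γ)).toMul)
        (fun _ _ h => congrArg Additive.toMul (cocycle_apply_homotopic c h)) p
      map_one' := congrArg Additive.toMul (cocycle_apply_const c x₀)
      map_mul' := fun p q => by
        induction p using Path.Homotopic.Quotient.ind with | _ p =>
        induction q using Path.Homotopic.Quotient.ind with | _ q =>
        exact congrArg Additive.toMul ((cocycle_apply_trans c q p).trans (add_comm _ _)) }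
  map_zero' := Additive.toMul.injective <| MonoidHom.ext fun p => by
    induction p using Path.Homotopic.Quotient.ind with | _ p => rfl
  map_add' c c' := Additive.toMul.injective <| MonoidHom.ext fun p => by
    induction p using Path.Homotopic.Quotient.ind with | _ p => rfl

variable (B x₀) in
theorem exists_isEvaluation [PathConnectedSpace X] :
    ∃ Ψ : SingularCohomology X (Additive B) 1 ≃+ Additive (FundamentalGroup X x₀ →* B),
      IsEvaluation Ψ := by
  have hker : (coboundaries X (Additive B) 1).addSubgroupOf (cocycles X (Additive B) 1) ≤
      (cocycleEvaluation B x₀).ker := by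
    rintro c ⟨b, hb⟩
    refine Additive.toMul.injective (MonoidHom.ext fun p => ?_)
    induction p using Path.Homotopic.Quotient.ind with | _ γ =>
    have h : c.1 (simplexOfPath γ) = 0 := by
      change _ = c.1 at hb
      rw [← hb]
      change ∑ i : Fin 2, (-1 : ℤ) ^ (i : ℕ) • b ((simplexOfPath γ).comp (faceMap 0 i)) = 0
      -- Both ends of a loop are `x₀`, so the two terms of the coboundary cancel.
      have hf (i : Fin 2) : (simplexOfPath γ).comp (faceMap 0 i) = ContinuousMap.const _ x₀ := by
        ext s
        obtain rfl : s = stdSimplex.vertex 0 := Subsingleton.elim _ _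
        change simplexOfPath γ (faceMap 0 i (stdSimplex.vertex 0)) = x₀
        rw [faceMap_vertex]
        fin_cases i
        · exact γ.target
        · exact γ.source
      simp [Fin.sum_univ_two, hf]
    exact congrArg Additive.toMul h
  let Ψ : SingularCohomology X (Additive B) 1 →+ Additive (FundamentalGroup X x₀ →* B) :=
    QuotientAddGroup.lift _ (cocycleEvaluation B x₀) hker
  refine ⟨AddEquiv.ofBijective Ψ ⟨?_, fun φ => ?_⟩, fun c γ => rfl⟩
  · rw [injective_iff_map_eq_zero]
    intro x hx
    induction x using QuotientAddGroup.induction_on with | _ c =>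
    exact cocycle_ext x₀ c fun γ => congrArg
      (fun ψ : Additive (FundamentalGroup X x₀ →* B) => ψ.toMul (Path.Homotopic.Quotient.mk γ)) hx
  · refine ⟨cohomologyClass ⟨_, transport_cocycle φ.toMul⟩,
      Additive.toMul.injective (MonoidHom.ext fun p => ?_)⟩
    induction p using Path.Homotopic.Quotient.ind with | _ γ =>
    refine Eq.trans ?_ (transport_loop φ.toMul _)
    exact apply_eq_of_forall_eq (transport φ.toMul) (pathOfSimplex_simplexOfPath_apply γ)

theorem IsEvaluation.eq {Ψ Ψ' : SingularCohomology X (Additive B) 1 ≃+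
    Additive (FundamentalGroup X x₀ →* B)} (h : IsEvaluation Ψ) (h' : IsEvaluation Ψ') :
    Ψ' = Ψ := by
  ext x : 1
  induction x using QuotientAddGroup.induction_on with | _ c =>
  refine Additive.toMul.injective (MonoidHom.ext fun p => ?_)
  induction p using Path.Homotopic.Quotient.ind with | _ γ =>
  exact (h' c γ).trans (h c γ).symm

theorem IsEvaluation.pullback {Y : Type*} [TopologicalSpace Y] {y₀ : Y} {f : C(X, Y)}
    (hf : f x₀ = y₀)
    {Ψ : SingularCohomology X (Additive B) 1 ≃+ Additive (FundamentalGroup X x₀ →* B)}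
    {Ψ' : SingularCohomology Y (Additive B) 1 ≃+ Additive (FundamentalGroup Y y₀ →* B)}
    (h : IsEvaluation Ψ) (h' : IsEvaluation Ψ') (x : SingularCohomology Y (Additive B) 1) :
    (Ψ (cohomologyPullback f 1 x)).toMul =
      (Ψ' x).toMul.comp (FundamentalGroup.mapOfEq f hf) := by
  subst hf
  induction x using QuotientAddGroup.induction_on with | _ c =>
  ext p
  induction p using Path.Homotopic.Quotient.ind with | _ γ =>
  refine (h _ γ).trans ?_
  rw [MonoidHom.comp_apply, FundamentalGroup.mapOfEq_apply]
  exact (h' c (γ.map f.continuous)).symm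

theorem IsEvaluation.coeff {B' : Type*} [CommGroup B'] (f : B →* B')
    {Ψ : SingularCohomology X (Additive B) 1 ≃+ Additive (FundamentalGroup X x₀ →* B)}
    {Ψ' : SingularCohomology X (Additive B') 1 ≃+ Additive (FundamentalGroup X x₀ →* B')}
    (h : IsEvaluation Ψ) (h' : IsEvaluation Ψ') (x : SingularCohomology X (Additive B) 1) :
    (Ψ' (cohomologyCoeff X f.toAdditive 1 x)).toMul = f.comp (Ψ x).toMul := by
  induction x using QuotientAddGroup.induction_on with | _ c =>
  ext p
  induction p using Path.Homotopic.Quotient.ind with | _ γ =>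
  refine (h' _ γ).trans ?_
  exact congrArg f (h c γ).symm

theorem cohomologyCoeff_leftInverse {A' : Type*} [AddCommGroup A'] (e : A ≃+ A') (n : ℕ) :
    Function.LeftInverse (cohomologyCoeff X e.symm.toAddMonoidHom n)
      (cohomologyCoeff X e.toAddMonoidHom n) := by
  intro x
  induction x using QuotientAddGroup.induction_on with | _ c =>
  refine congrArg QuotientAddGroup.mk (Subtype.ext (funext fun s => ?_))
  exact e.symm_apply_apply _

/-- An isomorphism of coefficient groups induces an isomorphism in cohomology. -/
def cohomologyCoeffEquiv {A' : Type*} [AddCommGroup A'] (e : A ≃+ A') (n : ℕ) :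
    SingularCohomology X A n ≃+ SingularCohomology X A' n where
  __ := cohomologyCoeff X e.toAddMonoidHom n
  invFun := cohomologyCoeff X e.symm.toAddMonoidHom n
  left_inv := cohomologyCoeff_leftInverse e n
  right_inv := cohomologyCoeff_leftInverse e.symm n

end EvaluationOnLoops

end SpinorClassification

namespace SpinorClassification

open MulOpposite Topology

/-! ### Path lifting and connectedness in principal bundles. -/

section PathLifting

/-- The interval is subdivided so that each piece lies in one trivialising set. The lift is extended
piece by piece, without any claim of uniqueness. -/
theorem exists_path_lift_of_trivializations {M F P : Type*} [TopologicalSpace M]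
    [TopologicalSpace F] [TopologicalSpace P] {π : P → M}
    (H : ∀ m, ∃ e : Bundle.Trivialization F π, m ∈ e.baseSet)
    (γ : C(unitInterval, M)) (p : P) (hp : γ 0 = π p) :
    ∃ Γ : C(unitInterval, P), (∀ t, π (Γ t) = γ t) ∧ Γ 0 = p := by
  choose e he using H
  obtain ⟨t, t_0, t_mono, ⟨n_max, h_max⟩, t_sub⟩ :=
    exists_monotone_Icc_subset_open_cover_unitInterval
      (fun x => (e x).open_baseSet.preimage γ.continuous)
      fun t _ => Set.mem_iUnion.2 ⟨γ t, he _⟩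
  suffices ∀ n, ∃ Γ : unitInterval → P, ContinuousOn Γ (Set.Icc 0 (t n)) ∧
      (∀ s ∈ Set.Icc 0 (t n), π (Γ s) = γ s) ∧ Γ 0 = p by
    obtain ⟨Γ, cont, eqOn, Γ_0⟩ := this n_max
    rw [h_max _ le_rfl, show Set.Icc (0 : unitInterval) 1 = Set.univ from
      Set.eq_univ_of_forall fun t => ⟨bot_le, le_top⟩] at cont eqOn
    exact ⟨⟨Γ, continuousOn_univ.mp cont⟩, fun t => eqOn t trivial, Γ_0⟩
  intro n
  induction n with
  | zero =>
    refine ⟨fun _ => p, continuous_const.continuousOn, fun s hs => ?_, rfl⟩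
    rw [t_0, Set.Icc_self, Set.mem_singleton_iff] at hs
    rw [hs, hp]
  | succ n ih =>
    obtain ⟨Γ, cont, eqOn, Γ_0⟩ := ih
    obtain ⟨x, t_sub⟩ := t_sub n
    have hΓ : π (Γ (t n)) = γ (t n) := eqOn _ ⟨t_0 ▸ t_mono n.zero_le, le_rfl⟩
    have hmem : Γ (t n) ∈ (e x).source := by
      rw [(e x).mem_source, hΓ]
      exact t_sub ⟨le_rfl, t_mono n.le_succ⟩
    -- On the new piece the fibre coordinate is frozen at its value at `t n`.
    refine ⟨fun s => if s ≤ t n then Γ s else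
      (e x).toOpenPartialHomeomorph.symm (γ s, (e x (Γ (t n))).2),
      .if (fun s hs => ?_) (cont.mono fun _ h => ?_) ?_, fun s hs => ?_, ?_⟩
    · cases frontier_Iic_subset _ hs.2
      rw [← hΓ, (e x).symm_apply_mk_proj hmem]
    · rw [closure_le_eq continuous_id' continuous_const] at h
      exact ⟨h.1.1, h.2⟩
    · apply (e x).continuousOn_invFun.comp ((Continuous.prodMk_left _).comp γ.2).continuousOn
      simp_rw [not_le, (e x).target_eq]
      intro s h
      exact ⟨t_sub ⟨closure_lt_subset_le continuous_const continuous_subtype_val h.2, h.1.2⟩, ⟨⟩⟩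
    · dsimp only
      split_ifs with h
      exacts [eqOn _ ⟨hs.1, h⟩, (e x).proj_symm_apply' (t_sub ⟨le_of_not_ge h, hs.2⟩)]
    · dsimp only
      rwa [if_pos (t_0 ▸ t_mono n.zero_le)]

end PathLifting

section PrincipalBundles

variable {EM EG EP : Type*}
  [NormedAddCommGroup EM] [NormedSpace ℝ EM] [NormedAddCommGroup EG] [NormedSpace ℝ EG]
  [NormedAddCommGroup EP] [NormedSpace ℝ EP]
  {M : Type*} [TopologicalSpace M] [ChartedSpace EM M]
  {G : Type*} [TopologicalSpace G] [ChartedSpace EG G] [Group G]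
  {P : Type*} [TopologicalSpace P] [ChartedSpace EP P] [MulAction Gᵐᵒᵖ P]
  {π : P → M}

namespace IsPrincipalBundle

theorem continuous_proj (hπ : IsPrincipalBundle EM EG EP G π) : Continuous π :=
  hπ.contMDiff_proj.continuous

theorem continuous_action (hπ : IsPrincipalBundle EM EG EP G π) :
    Continuous fun x : P × G => op x.2 • x.1 :=
  hπ.contMDiff_action.continuous

theorem proj_smul (hπ : IsPrincipalBundle EM EG EP G π) (p : P) (g : G) :
    π (op g • p) = π p :=
  ((hπ.proj_eq_iff _ _).2 ⟨g, rfl⟩).symm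

theorem eq_of_smul_eq (hπ : IsPrincipalBundle EM EG EP G π) {p : P} {g g' : G}
    (h : op g • p = op g' • p) : g = g' := by
  have := hπ.free p (g * g'⁻¹) (by rw [op_mul, mul_smul, h, ← mul_smul, ← op_mul]; simp)
  exact mul_inv_eq_one.1 this

/-- The translation function is continuous: in an equivariant trivialisation it is the quotient of
the two fibre coordinates. -/
theorem continuousOn_of_smul_eq [IsTopologicalGroup G] (hπ : IsPrincipalBundle EM EG EP G π)
    {T : Type*} [TopologicalSpace T] {s : Set T} {f f' : T → P} {g : T → G}
    (hf : ContinuousOn f s) (hf' : ContinuousOn f' s) (h : ∀ t ∈ s, op (g t) • f t = f' t) :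
    ContinuousOn g s := by
  intro t ht
  obtain ⟨e, he, -, -, heq⟩ := hπ.exists_trivialization (π (f t))
  have hs : f t ∈ e.source := e.mem_source.2 he
  have hs' : f' t ∈ e.source := by
    rw [e.mem_source, ← h t ht, hπ.proj_smul]
    exact he
  have hc : ContinuousWithinAt (fun t => ((e (f t)).2)⁻¹ * (e (f' t)).2) s t :=
    (((e.continuousAt hs).snd.comp_continuousWithinAt (hf t ht)).inv).mul
      ((e.continuousAt hs').snd.comp_continuousWithinAt (hf' t ht))
  refine hc.congr_of_eventuallyEq ?_ ?_
  · filter_upwards [(hf t ht).preimage_mem_nhdsWithin (e.open_source.mem_nhds hs),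
      self_mem_nhdsWithin] with t' ht' hts
    rw [← h t' hts, heq _ ht', inv_mul_cancel_left]
  · rw [← h t ht, heq _ hs, inv_mul_cancel_left]

theorem exists_path_lift (hπ : IsPrincipalBundle EM EG EP G π) (γ : C(unitInterval, M)) (p : P)
    (hp : γ 0 = π p) : ∃ Γ : C(unitInterval, P), (∀ t, π (Γ t) = γ t) ∧ Γ 0 = p :=
  exists_path_lift_of_trivializations
    (fun m => (hπ.exists_trivialization m).imp fun _ h => h.1) γ p hp

/-- The path `p · g(t)` in a fibre. -/
def orbitPath (hπ : IsPrincipalBundle EM EG EP G π) (p : P) {g g' : G} (γ : Path g g') :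
    Path (op g • p) (op g' • p) :=
  γ.map (f := fun g => op g • p) (hπ.continuous_action.comp (Continuous.prodMk_right p))

theorem pathConnectedSpace [PathConnectedSpace G] [PathConnectedSpace M]
    (hπ : IsPrincipalBundle EM EG EP G π) : PathConnectedSpace P := by
  obtain ⟨m⟩ := (inferInstance : Nonempty M)
  obtain ⟨p, rfl⟩ := hπ.surjective_proj m
  have key (q : P) : Joined p q := by
    obtain ⟨Γ, hΓ, h0⟩ := hπ.exists_path_lift (PathConnectedSpace.somePath (π q) (π p)) q (by simp)
    obtain ⟨g, hg⟩ := (hπ.proj_eq_iff p (Γ 1)).1 (by simp [hΓ])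
    have h₁ : Joined p (op g • p) := ⟨(hπ.orbitPath p
      (PathConnectedSpace.somePath 1 g)).cast (by simp) rfl⟩
    rw [hg] at h₁
    exact h₁.trans (Joined.symm ⟨⟨Γ, h0, rfl⟩⟩)
  exact ⟨⟨p⟩, fun q q' => (key q).symm.trans (key q')⟩

/-- A loop in the base lifts to a path from `p` to some `p · g`, which a path in the connected fibre
closes up. The projection of the closing path is constant. -/
theorem projPiOne_surjective [PathConnectedSpace G] (hπ : IsPrincipalBundle EM EG EP G π) {p : P}
    {m : M} (h : π p = m) : Function.Surjective (hπ.projPiOne h) := by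
  subst h
  intro x
  induction x using Path.Homotopic.Quotient.ind with | _ γ =>
  obtain ⟨Γ, hΓ, h0⟩ := hπ.exists_path_lift γ p (by simp)
  obtain ⟨g, hg⟩ := (hπ.proj_eq_iff p (Γ 1)).1 (by simp [hΓ])
  let δ : Path p (op g • p) := ⟨Γ, h0, hg.symm⟩
  let ε : Path (op g • p) p :=
    (hπ.orbitPath p (PathConnectedSpace.somePath g 1)).cast rfl (by simp)
  refine ⟨FundamentalGroup.fromPath (.mk (δ.trans ε)), ?_⟩
  rw [projPiOne, FundamentalGroup.mapOfEq_apply]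
  change Path.Homotopic.Quotient.mk ((δ.trans ε).map hπ.continuous_proj) = _
  have hε : ε.map hπ.continuous_proj = (Path.refl (π p)).cast (hπ.proj_smul p g) rfl := by
    ext t
    exact hπ.proj_smul p _
  have hδ : δ.map hπ.continuous_proj = γ.cast rfl (hπ.proj_smul p g) := by
    ext t
    exact hΓ t
  rw [Path.map_trans, hε, hδ]
  have : (γ.cast rfl (hπ.proj_smul p g)).trans
      ((Path.refl (π p)).cast (hπ.proj_smul p g) rfl) = γ.trans (Path.refl _) := by
    ext t
    simp [Path.trans_apply]
  rw [this, Path.Homotopic.Quotient.mk_trans, Path.Homotopic.Quotient.mk_refl,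
    Path.Homotopic.Quotient.trans_refl]

end IsPrincipalBundle

end PrincipalBundles

end SpinorClassification

namespace SpinorClassification

open MulOpposite Topology

/-! ### Spinor maps as finite coverings. -/

section SpinorMaps

variable (EM EG : Type*) {EP : Type*}
  [NormedAddCommGroup EM] [NormedSpace ℝ EM] [NormedAddCommGroup EG] [NormedSpace ℝ EG]
  [NormedAddCommGroup EP] [NormedSpace ℝ EP]
  {M : Type*} [TopologicalSpace M] [ChartedSpace EM M]
  {G : Type*} [TopologicalSpace G] [ChartedSpace EG G] [Group G]
  {Gt : Type*} [TopologicalSpace Gt] [ChartedSpace EG Gt] [Group Gt]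
  {P : Type*} [TopologicalSpace P] [ChartedSpace EP P] [MulAction Gᵐᵒᵖ P]
  {Q : Type*} [TopologicalSpace Q] [ChartedSpace EP Q] [MulAction Gtᵐᵒᵖ Q]

/-- `u : Q → P` is a smooth map of principal bundles over `M` which is equivariant along `ρ`. -/
structure IsSpinorMap (π : P → M) (ρ : Gt →* G) (proj : Q → M) (u : Q → P) : Prop where
  isPrincipalBundle : IsPrincipalBundle EM EG EP Gt proj
  contMDiff : ContMDiff 𝓘(ℝ, EP) 𝓘(ℝ, EP) ∞ u
  proj_apply : ∀ q, π (u q) = proj q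
  map_smul : ∀ (q : Q) (g : Gt), u (op g • q) = op (ρ g) • u q

variable {EM EG} {π : P → M} {ρ : Gt →* G} {proj : Q → M} {u : Q → P}

/-- With `t` a local section of `Q`, a point `p` is `u(t(π p)) · g(p)` for a smooth `g` with `g(u q)
= 1`. Lifting `g` through the local diffeomorphism ρ at 1 gives the inverse. -/
theorem IsSpinorMap.exists_local_inverse [LieGroup 𝓘(ℝ, EG) ∞ G]
    (hπ : IsPrincipalBundle EM EG EP G π) (hρ : IsUniversalCoveringGroup EG ρ)
    (hu : IsSpinorMap EM EG (EP := EP) π ρ proj u) (q : Q) :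
    ∃ (v : P → Q) (W : Set P), IsOpen W ∧ u q ∈ W ∧
      ContMDiffOn 𝓘(ℝ, EP) 𝓘(ℝ, EP) ∞ v W ∧ v (u q) = q ∧ ∀ p ∈ W, u (v p) = p := by
  obtain ⟨e, he, -, hes, -⟩ := hu.isPrincipalBundle.exists_trivialization (proj q)
  obtain ⟨e', he', hes', -, heq⟩ := hπ.exists_trivialization (proj q)
  obtain ⟨Φ, hΦ, hΦρ⟩ := hρ.isLocalDiffeomorph 1
  set t : M → Q := fun m => e.toOpenPartialHomeomorph.symm (m, (e q).2) with ht
  have htq : t (proj q) = q := e.symm_apply_mk_proj (e.mem_source.2 he)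
  have htp {m : M} (hm : m ∈ e.baseSet) : proj (t m) = m := e.proj_symm_apply' hm
  have hts : ContMDiffOn 𝓘(ℝ, EM) 𝓘(ℝ, EP) ∞ t e.baseSet :=
    -- The section keeps the fibre coordinate of `q`, so that it passes through `q` itself.
    hes.comp (contMDiffOn_id.prodMk contMDiffOn_const) fun m hm => e.mem_target.2 hm
  set A : Set P := π ⁻¹' (e.baseSet ∩ e'.baseSet) with hA
  have hAo : IsOpen A := (e.open_baseSet.inter e'.open_baseSet).preimage hπ.continuous_proj
  have htA : ContMDiffOn 𝓘(ℝ, EP) 𝓘(ℝ, EP) ∞ (fun p => t (π p)) A :=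
    hts.comp hπ.contMDiff_proj.contMDiffOn fun p hp => hp.1
  set g : P → G := fun p => ((e' (u (t (π p)))).2)⁻¹ * (e' p).2 with hg
  have hgA : ContMDiffOn 𝓘(ℝ, EP) 𝓘(ℝ, EG) ∞ g A := by
    refine ContMDiffOn.mul (ContMDiffOn.inv ?_) ?_
    · refine contMDiff_snd.comp_contMDiffOn
        (hes'.comp (hu.contMDiff.comp_contMDiffOn htA) fun p hp => ?_)
      rw [Set.mem_preimage, e'.mem_source]
      rw [hu.proj_apply, htp hp.1]
      exact hp.2
    · exact contMDiff_snd.comp_contMDiffOn (hes'.mono fun p hp => e'.mem_source.2 hp.2)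
  have hgq : g (u q) = 1 := by simp [hg, hu.proj_apply, htq]
  have hΦ1 : Φ 1 = 1 := by rw [← hΦρ hΦ, map_one]
  refine ⟨fun p => op (Φ.symm (g p)) • t (π p), A ∩ g ⁻¹' Φ.target,
    hgA.continuousOn.isOpen_inter_preimage hAo Φ.open_target, ⟨?_, ?_⟩, ?_, ?_, fun p hp => ?_⟩
  · simp only [hA, Set.mem_preimage, hu.proj_apply]
    exact ⟨he, he'⟩
  · rw [Set.mem_preimage, hgq, ← hΦ1]
    exact Φ.map_source hΦ
  · exact hu.isPrincipalBundle.contMDiff_action.comp_contMDiffOn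
      ((htA.mono Set.inter_subset_left).prodMk
        (Φ.contMDiffOn_invFun.comp (hgA.mono Set.inter_subset_left) fun p hp => hp.2))
  · have : Φ.symm (g (u q)) = 1 := by
      rw [hgq, ← hΦ1]
      exact Φ.left_inv hΦ
    simp only [this, hu.proj_apply, htq, op_one, one_smul]
  · have h₁ : ρ (Φ.symm (g p)) = g p :=
      (hΦρ (Φ.map_target hp.2)).trans (Φ.right_inv hp.2)
    have hp' : p ∈ e'.source := e'.mem_source.2 hp.1.2
    have hπt : π (u (t (π p))) = π p := by rw [hu.proj_apply, htp hp.1.1]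
    have hs : u (t (π p)) ∈ e'.source := by
      rw [e'.mem_source, hπt]
      exact hp.1.2
    have hs' : op (g p) • u (t (π p)) ∈ e'.source := by
      rw [e'.mem_source, hπ.proj_smul, hπt]
      exact hp.1.2
    change u (op (Φ.symm.toPartialEquiv (g p)) • t (π p)) = p
    rw [hu.map_smul, h₁]
    refine e'.injOn hs' hp' (Prod.ext ?_ ?_)
    · exact (e'.coe_fst hs').trans ((hπ.proj_smul _ _).trans (hπt.trans (e'.coe_fst hp').symm))
    · exact (heq _ hs _).trans (mul_inv_cancel_left _ _)

theorem IsSpinorMap.surjective (hπ : IsPrincipalBundle EM EG EP G π)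
    (hρ : Function.Surjective ρ) (hu : IsSpinorMap EM EG (EP := EP) π ρ proj u) :
    Function.Surjective u := by
  intro p
  obtain ⟨q, hq⟩ := hu.isPrincipalBundle.surjective_proj (π p)
  obtain ⟨g, hg⟩ := (hπ.proj_eq_iff (u q) p).1 (by rw [hu.proj_apply, hq])
  obtain ⟨g, rfl⟩ := hρ g
  exact ⟨op g • q, by rw [hu.map_smul, hg]⟩

theorem IsSpinorMap.eq_iff_mem_orbit (hπ : IsPrincipalBundle EM EG EP G π)
    (hu : IsSpinorMap EM EG (EP := EP) π ρ proj u) {q q' : Q} :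
    u q = u q' ↔ q ∈ MulAction.orbit ρ.ker.op q' := by
  constructor
  · intro h
    obtain ⟨g, rfl⟩ := (hu.isPrincipalBundle.proj_eq_iff q' q).1
      (by rw [← hu.proj_apply, ← hu.proj_apply, h])
    refine ⟨⟨op g, hπ.free (u q') (ρ g) ?_⟩, rfl⟩
    rw [← hu.map_smul, h]
  · rintro ⟨⟨g, hg⟩, rfl⟩
    change u (op g.unop • q') = u q'
    rw [hu.map_smul, show ρ g.unop = 1 from hg, op_one, one_smul]

/-- The local inverses make `u` open, hence a quotient map whose fibres are the orbits of ker ρ. A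
free action of a finite group on a locally compact Hausdorff space gives a covering. -/
theorem IsSpinorMap.isQuotientCoveringMap [LieGroup 𝓘(ℝ, EG) ∞ G] [FiniteDimensional ℝ EP]
    [T2Space Q] [Finite ρ.ker]
    (hπ : IsPrincipalBundle EM EG EP G π) (hρ : IsUniversalCoveringGroup EG ρ)
    (hu : IsSpinorMap EM EG (EP := EP) π ρ proj u) : IsQuotientCoveringMap u ρ.ker.op := by
  have hopen : IsOpenMap u := by
    rw [isOpenMap_iff_nhds_le]
    intro q
    obtain ⟨v, W, hW, hqW, hv, hvq, huv⟩ := hu.exists_local_inverse hπ hρ q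
    have hc : Filter.Tendsto v (𝓝 (u q)) (𝓝 q) := by
      have := (hv.continuousOn.continuousAt (hW.mem_nhds hqW)).tendsto
      rwa [hvq] at this
    refine Filter.le_def.2 fun s hs => ?_
    filter_upwards [hc (Filter.mem_map.1 hs), hW.mem_nhds hqW] with p hp hpW
    have : u (v p) ∈ s := hp
    rwa [huv p hpW] at this
  have hq : IsQuotientMap u :=
    hopen.isQuotientMap hu.contMDiff.continuous (hu.surjective hπ hρ.surjective)
  have : Finite ρ.ker.op := Finite.of_equiv _ ρ.ker.equivOp
  have : LocallyCompactSpace Q := ChartedSpace.locallyCompactSpace EP Q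
  have : ContinuousConstSMul ρ.ker.op Q := ⟨fun g =>
    hu.isPrincipalBundle.continuous_action.comp (Continuous.prodMk_left (unop g.1))⟩
  have : IsCancelSMul ρ.ker.op Q :=
    { left_cancel' := fun g q q' h => smul_left_cancel g h
      right_cancel' := fun g g' q h => Subtype.ext (unop_injective
        (hu.isPrincipalBundle.eq_of_smul_eq h)) }
  exact hq.isQuotientCoveringMap_of_properlyDiscontinuousSMul (hu.eq_iff_mem_orbit hπ)

end SpinorMaps

/-- A closed map with finite fibres pulls paracompactness back. It is needed for the total spaces
obtained by twisting. -/
theorem _root_.IsQuotientCoveringMap.paracompactSpace {Q P K : Type*} [TopologicalSpace Q]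
    [TopologicalSpace P] [Group K] [Finite K] [MulAction K Q] {u : Q → P} [ParacompactSpace P]
    (hu : IsQuotientCoveringMap u K) : ParacompactSpace Q := by
  have := hu.toContinuousConstSMul
  have hclosed : IsClosedMap u := by
    intro C hC
    rw [← hu.isClosed_preimage]
    have : u ⁻¹' (u '' C) = ⋃ k : K, (k • ·) ⁻¹' C := by
      ext q
      simp only [Set.mem_preimage, Set.mem_image, Set.mem_iUnion]
      constructor
      · rintro ⟨q', hq', h⟩
        obtain ⟨k, rfl⟩ := hu.apply_eq_iff_mem_orbit.1 h
        exact ⟨k, hq'⟩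
      · rintro ⟨k, hk⟩
        exact ⟨_, hk, hu.map_smul k⟩
    rw [this]
    exact isClosed_iUnion_of_finite fun k => hC.preimage (continuous_const_smul k)
  refine ⟨fun α s hs hcov => ?_⟩
  have hk (q : Q) : ∃ a, q ∈ s a := Set.mem_iUnion.1 (hcov ▸ Set.mem_univ q)
  choose a ha using hk
  -- The points whose whole fibre is covered by the sets selected for the fibre of `p`.
  let W (p : P) : Set P := (u '' (⋃ q ∈ u ⁻¹' {p}, s (a q))ᶜ)ᶜ
  have hWo (p : P) : IsOpen (W p) :=
    (hclosed _ (isOpen_biUnion fun q _ => hs _).isClosed_compl).isOpen_compl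
  have hpW (p : P) : p ∈ W p := by
    rintro ⟨q, hq, rfl⟩
    exact hq (Set.mem_biUnion (x := q) rfl (ha q))
  have hWs (p : P) (q' : Q) (h : u q' ∈ W p) : ∃ q, u q = p ∧ q' ∈ s (a q) := by
    by_contra hc
    refine h ⟨q', fun h' => hc ?_, rfl⟩
    simpa using h'
  obtain ⟨V, hVo, hVcov, hVfin, hVW⟩ := precise_refinement W hWo
    (Set.eq_univ_of_forall fun p => Set.mem_iUnion.2 ⟨p, hpW p⟩)
  refine ⟨Q, fun q => u ⁻¹' V (u q) ∩ s (a q),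
    fun q => ((hVo _).preimage hu.continuous).inter (hs _), ?_, ?_,
    fun q => ⟨_, Set.inter_subset_right⟩⟩
  · refine Set.eq_univ_of_forall fun q' => ?_
    have : u q' ∈ ⋃ i, V i := hVcov ▸ Set.mem_univ _
    obtain ⟨p, hp⟩ := Set.mem_iUnion.1 this
    obtain ⟨q, rfl, hq⟩ := hWs p q' (hVW p hp)
    exact Set.mem_iUnion.2 ⟨q, hp, hq⟩
  · intro q'
    obtain ⟨t, ht, hfin⟩ := hVfin (u q')
    refine ⟨u ⁻¹' t, hu.continuous.continuousAt ht,
      (hfin.preimage' (f := u) fun p _ => ?_).subset ?_⟩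
    · obtain ⟨q, rfl⟩ := hu.surjective p
      refine (Set.finite_range fun k : K => k • q).subset fun q' hq' => ?_
      exact hu.apply_eq_iff_mem_orbit.1 hq'
    · rintro q ⟨x, ⟨hx, -⟩, hxt⟩
      exact ⟨u x, hx, hxt⟩

end SpinorClassification

namespace SpinorClassification

open MulOpposite Topology

/-! ### Monodromy of coverings with a deck group of order two. -/

section QuotientCovering

variable {E X K : Type*} [TopologicalSpace E] [TopologicalSpace X] [Group K] [MulAction K E]
  {p : E → X} {x : X}

/-- For a commutative deck group the displacement of a lift does not depend on its starting point in
the fibre, so any lift computes the monodromy. -/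
theorem _root_.IsQuotientCoveringMap.toMulOpposite_eq (hp : IsQuotientCoveringMap p K)
    (hK : ∀ g g' : K, g * g' = g' * g) (e : p ⁻¹' {x}) (γ : Path x x) (Γ : C(unitInterval, E))
    (hΓ : ∀ t, p (Γ t) = γ t) {g : K} (h : Γ 1 = g • Γ 0) :
    hp.fundamentalGroupToMulOpposite e (FundamentalGroup.fromPath (.mk γ)) = op g := by
  rw [hp.fundamentalGroupToMulOpposite_apply_eq_Iff]
  have h₀ : p (Γ 0) = x := by rw [hΓ, γ.source]
  obtain ⟨k, rfl⟩ := hp.exists_toPermFiber_eq ⟨Γ 0, h₀⟩ e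
  rw [hp.monodromy_toPermFiber, unop_op]
  have hm : (hp.isCoveringMap.monodromy (.mk γ) ⟨Γ 0, h₀⟩).1 = Γ 1 :=
    congrArg (fun Γ' : C(unitInterval, E) => Γ' 1)
      ((hp.isCoveringMap.eq_liftPath_iff' (by simp [hΓ])).2 ⟨funext hΓ, rfl⟩).symm
  rw [hp.toPermFiber_apply_apply_coe, hp.toPermFiber_apply_apply_coe, hm, h, ← mul_smul,
    ← mul_smul, hK]

theorem _root_.IsQuotientCoveringMap.exists_lift_smul (hp : IsQuotientCoveringMap p K)
    (hK : ∀ g g' : K, g * g' = g' * g) (e e' : p ⁻¹' {x}) (γ : Path x x) :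
    ∃ Γ : C(unitInterval, E), (∀ t, p (Γ t) = γ t) ∧ Γ 0 = e' ∧ Γ 1 =
      (hp.fundamentalGroupToMulOpposite e (FundamentalGroup.fromPath (.mk γ))).unop • e'.1 := by
  obtain ⟨Γ, hΓ, h₀⟩ := hp.isCoveringMap.exists_path_lifts γ e' (by simpa using e'.2.symm)
  have hΓ' (t : unitInterval) : p (Γ t) = γ t := congrFun hΓ t
  obtain ⟨g, hg⟩ := hp.apply_eq_iff_mem_orbit.1
    (show p (Γ 1) = p (Γ 0) by rw [hΓ', hΓ', γ.source, γ.target])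
  refine ⟨Γ, hΓ', h₀, ?_⟩
  rw [hp.toMulOpposite_eq hK e γ Γ hΓ' hg.symm, ← h₀]
  exact hg.symm

/-- Conjugation permutes `N` and fixes 1, hence fixes the only other element. -/
theorem commute_of_mem_of_card_eq_two {H : Type*} [Group H] {N : Subgroup H} [N.Normal]
    (hN : Nat.card N = 2) {k : H} (hk : k ∈ N) (g : H) : g * k = k * g := by
  by_cases h1 : k = 1
  · simp [h1]
  obtain ⟨y, -, hy⟩ := (Nat.card_eq_two_iff' (1 : N)).1 hN
  have hc : g * k * g⁻¹ ∈ N := Subgroup.Normal.conj_mem inferInstance k hk g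
  have e₁ := hy ⟨k, hk⟩ fun h => h1 (congrArg Subtype.val h)
  have e₂ := hy ⟨_, hc⟩ fun h => h1 (by
    have := congrArg Subtype.val h
    simpa using this)
  have := congrArg Subtype.val (e₂.trans e₁.symm)
  exact mul_inv_eq_iff_eq_mul.1 this

theorem kerOp_mul_comm {G Gt : Type*} [Group G] [Group Gt] {ρ : Gt →* G}
    (hcard : Nat.card ρ.ker = 2) (g g' : ρ.ker.op) : g * g' = g' * g :=
  Subtype.ext (unop_injective
    (commute_of_mem_of_card_eq_two hcard (show unop g.1 ∈ ρ.ker from g.2) (unop g'.1)))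

end QuotientCovering

section Monodromy

variable {G : Type*} [TopologicalSpace G] [Group G]
  {Gt : Type*} [TopologicalSpace Gt] [Group Gt] {ρ : Gt →* G}
  {P Q : Type*} [TopologicalSpace P] [TopologicalSpace Q]
  [MulAction Gtᵐᵒᵖ Q] {u : Q → P} {p : P}

variable [SimplyConnectedSpace Gt] (hρ : IsQuotientCoveringMap ρ ρ.ker.op)

/-- The fundamental group of `G` is the kernel of the universal covering. -/
def piOneEquivKer : FundamentalGroup G (1 : G) ≃* (ρ.ker.op)ᵐᵒᵖ :=
  hρ.fundamentalGroupEquiv ⟨1, map_one ρ⟩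

/-- The monodromy of the covering `u` of `P`, with values in `π₁(G)`. -/
def monodromyHom (hu : IsQuotientCoveringMap u ρ.ker.op) (q : u ⁻¹' {p}) :
    FundamentalGroup P p →* FundamentalGroup G (1 : G) :=
  (piOneEquivKer hρ).symm.toMonoidHom.comp (hu.fundamentalGroupToMulOpposite q)

variable {hρ} {hu : IsQuotientCoveringMap u ρ.ker.op}

theorem monodromyHom_eq (hcard : Nat.card ρ.ker = 2) (q : u ⁻¹' {p}) (γ : Path p p)
    (Γ : C(unitInterval, Q)) (hΓ : ∀ t, u (Γ t) = γ t) {g : ρ.ker.op} (h : Γ 1 = g • Γ 0) :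
    monodromyHom hρ hu q (FundamentalGroup.fromPath (.mk γ)) = (piOneEquivKer hρ).symm (op g) :=
  congrArg (piOneEquivKer hρ).symm (hu.toMulOpposite_eq (kerOp_mul_comm hcard) q γ Γ hΓ h)

theorem exists_lift_monodromyHom (hcard : Nat.card ρ.ker = 2) (q q' : u ⁻¹' {p}) (γ : Path p p) :
    ∃ Γ : C(unitInterval, Q), (∀ t, u (Γ t) = γ t) ∧ Γ 0 = q' ∧ Γ 1 = (piOneEquivKer hρ
      (monodromyHom hρ hu q (FundamentalGroup.fromPath (.mk γ)))).unop • q'.1 := by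
  obtain ⟨Γ, h⟩ := hu.exists_lift_smul (kerOp_mul_comm hcard) q q' γ
  refine ⟨Γ, ?_⟩
  rw [monodromyHom, MonoidHom.comp_apply]
  erw [MulEquiv.apply_symm_apply]
  exact h

/-- The loops in the image of `u_*` are those that lift to loops, that is, those with trivial
monodromy. -/
theorem mem_range_iff_monodromyHom_eq_one (q : u ⁻¹' {p}) (γ : FundamentalGroup P p) :
    γ ∈ (FundamentalGroup.mapOfEq (⟨u, hu.continuous⟩ : C(Q, P)) q.2).range ↔
      monodromyHom hρ hu q γ = 1 := by
  rw [← hu.ker_monodromyPerm q, ← hu.ker_fundamentalGroupToMulOpposite q, MonoidHom.mem_ker]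
  exact (EmbeddingLike.map_eq_one_iff (f := (piOneEquivKer hρ).symm)).symm

theorem monodromyHom_independent (hcard : Nat.card ρ.ker = 2) (q q' : u ⁻¹' {p}) :
    monodromyHom hρ hu q = monodromyHom hρ hu q' := by
  ext γ
  induction γ using Path.Homotopic.Quotient.ind with | _ γ =>
  obtain ⟨Γ, hΓ, h₀, h₁⟩ := exists_lift_monodromyHom (hρ := hρ) (hu := hu) hcard q' q' γ
  refine (monodromyHom_eq hcard q γ Γ hΓ (h₁.trans (by rw [h₀]))).trans ?_
  exact (piOneEquivKer hρ).symm_apply_apply _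

/-- If `Γ` lifts a loop of `G` through ρ, then `q · Γ` lifts its image in the orbit, with the same
displacement. Hence the monodromy is a left inverse of `i_*`. -/
theorem monodromyHom_orbit [MulAction Gᵐᵒᵖ P] (hcard : Nat.card ρ.ker = 2)
    (hQ : Continuous fun x : Q × Gt => op x.2 • x.1)
    (hsmul : ∀ (q : Q) (g : Gt), u (op g • q) = op (ρ g) • u q)
    (hP : Continuous fun g : G => op g • p) (q : u ⁻¹' {p})
    (a : FundamentalGroup G (1 : G)) :
    monodromyHom hρ hu q (FundamentalGroup.mapOfEq (⟨fun g => op g • p, hP⟩ : C(G, P))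
      (by simp) a) = a := by
  induction a using Path.Homotopic.Quotient.ind with | _ γ =>
  obtain ⟨Γ, hΓ, h₀, h₁⟩ := hρ.exists_lift_smul (kerOp_mul_comm hcard)
    ⟨1, map_one ρ⟩ ⟨1, map_one ρ⟩ γ
  rw [FundamentalGroup.mapOfEq_apply]
  refine (monodromyHom_eq hcard q ((γ.map hP).cast (by simp) (by simp))
    ⟨fun t => op (Γ t) • q.1, hQ.comp (continuous_const.prodMk Γ.continuous)⟩ (fun t => ?_)
    (g := (hρ.fundamentalGroupToMulOpposite ⟨1, map_one ρ⟩
      (FundamentalGroup.fromPath (.mk γ))).unop) ?_).trans ?_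
  · change u (op (Γ t) • q.1) = op (γ t) • p
    rw [hsmul, hΓ, q.2]
  · change op (Γ 1) • q.1 = _ • op (Γ 0) • q.1
    rw [h₀, h₁, op_one, one_smul]
    change op (1 * unop _) • _ = _
    rw [one_mul, op_unop]
    rfl
  · exact (piOneEquivKer hρ).symm_apply_apply _

end Monodromy

end SpinorClassification

namespace SpinorClassification

open MulOpposite Topology

theorem IsUniversalCoveringGroup.isQuotientCoveringMap {EG : Type*} [NormedAddCommGroup EG]
    [NormedSpace ℝ EG] {G : Type*} [TopologicalSpace G] [ChartedSpace EG G] [Group G]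
    {Gt : Type*} [TopologicalSpace Gt] [ChartedSpace EG Gt] [Group Gt] [IsTopologicalGroup Gt]
    [T2Space Gt] {ρ : Gt →* G} [Finite ρ.ker] (hρ : IsUniversalCoveringGroup EG ρ) :
    IsQuotientCoveringMap ρ ρ.ker.op := by
  refine (hρ.isCoveringMap.isQuotientMap hρ.surjective).isQuotientCoveringMap_of_subgroupOp _
    (Set.Finite.isDiscrete (Set.toFinite (ρ.ker : Set Gt))) fun {g g'} => ?_
  rw [MonoidHom.mem_ker, map_mul, map_inv, inv_mul_eq_one]

theorem SpinorStructure.isSpinorMap {EM EG EP : Type*}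
    [NormedAddCommGroup EM] [NormedSpace ℝ EM] [NormedAddCommGroup EG] [NormedSpace ℝ EG]
    [NormedAddCommGroup EP] [NormedSpace ℝ EP]
    {M : Type*} [TopologicalSpace M] [ChartedSpace EM M] {G : Type*} [Group G]
    {Gt : Type*} [TopologicalSpace Gt] [ChartedSpace EG Gt] [Group Gt]
    {P : Type u} [TopologicalSpace P] [ChartedSpace EP P] [MulAction Gᵐᵒᵖ P]
    {π : P → M} {ρ : Gt →* G} (S : SpinorStructure EM EG (EP := EP) π ρ) :
    IsSpinorMap EM EG (EP := EP) π ρ S.proj S.spinorMap :=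
  ⟨S.isPrincipalBundle, S.contMDiff_spinorMap, S.proj_spinorMap, S.spinorMap_smul⟩

/-! ### The monodromy of a spinor structure as a complete invariant. -/

section Holonomy

variable {EM EG EP : Type*}
  [NormedAddCommGroup EM] [NormedSpace ℝ EM] [NormedAddCommGroup EG] [NormedSpace ℝ EG]
  [NormedAddCommGroup EP] [NormedSpace ℝ EP]
  {M : Type*} [TopologicalSpace M] [ChartedSpace EM M]
  {G : Type*} [TopologicalSpace G] [ChartedSpace EG G] [Group G]
  {Gt : Type*} [TopologicalSpace Gt] [ChartedSpace EG Gt] [Group Gt]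
  {P : Type u} [TopologicalSpace P] [ChartedSpace EP P] [MulAction Gᵐᵒᵖ P]
  {π : P → M} {ρ : Gt →* G}

namespace SpinorStructure

theorem isQuotientCoveringMap [LieGroup 𝓘(ℝ, EG) ∞ G] [FiniteDimensional ℝ EP]
    (hπ : IsPrincipalBundle EM EG EP G π)
    (hρ : IsUniversalCoveringGroup EG ρ) (hcard : Nat.card ρ.ker = 2)
    (S : SpinorStructure EM EG (EP := EP) π ρ) :
    IsQuotientCoveringMap S.spinorMap ρ.ker.op :=
  have : Finite ρ.ker := Nat.finite_of_card_ne_zero (by rw [hcard]; exact two_ne_zero)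
  S.isSpinorMap.isQuotientCoveringMap hπ hρ

theorem _root_.SpinorClassification.IsUniversalCoveringGroup.isQuotientCoveringMap_of_card
    [LieGroup 𝓘(ℝ, EG) ∞ Gt] [T2Space Gt]
    (hρ : IsUniversalCoveringGroup EG ρ) (hcard : Nat.card ρ.ker = 2) :
    IsQuotientCoveringMap ρ ρ.ker.op :=
  have : Finite ρ.ker := Nat.finite_of_card_ne_zero (by rw [hcard]; exact two_ne_zero)
  have : IsTopologicalGroup Gt := topologicalGroup_of_lieGroup 𝓘(ℝ, EG) ∞
  hρ.isQuotientCoveringMap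

variable [LieGroup 𝓘(ℝ, EG) ∞ G] [LieGroup 𝓘(ℝ, EG) ∞ Gt]
  [FiniteDimensional ℝ EP] [T2Space Gt]

/-- The isomorphism from `π₁(G)` to the kernel of the universal covering. -/
def kerEquiv (hρ : IsUniversalCoveringGroup EG ρ) (hcard : Nat.card ρ.ker = 2) :
    FundamentalGroup G (1 : G) ≃* (ρ.ker.op)ᵐᵒᵖ :=
  have := hρ.simplyConnected
  piOneEquivKer (hρ.isQuotientCoveringMap_of_card hcard)

/-- The monodromy of the covering `u : Q → P` given by a spinor structure. -/
def holonomy (hπ : IsPrincipalBundle EM EG EP G π)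
    (hρ : IsUniversalCoveringGroup EG ρ) (hcard : Nat.card ρ.ker = 2)
    (S : SpinorStructure EM EG (EP := EP) π ρ) (p : P) :
    FundamentalGroup P p →* FundamentalGroup G (1 : G) :=
  have := hρ.simplyConnected
  have hu := S.isQuotientCoveringMap hπ hρ hcard
  monodromyHom (hρ.isQuotientCoveringMap_of_card hcard) hu
    ⟨(hu.surjective p).choose, (hu.surjective p).choose_spec⟩

variable (hπ : IsPrincipalBundle EM EG EP G π) (hρ : IsUniversalCoveringGroup EG ρ)
  (hcard : Nat.card ρ.ker = 2) (S S' : SpinorStructure EM EG (EP := EP) π ρ)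

theorem holonomy_eq {p : P} (γ : Path p p) (Γ : C(unitInterval, S.Q))
    (hΓ : ∀ t, S.spinorMap (Γ t) = γ t) {g : ρ.ker.op} (h : Γ 1 = g.1 • Γ 0) :
    S.holonomy hπ hρ hcard p (FundamentalGroup.fromPath (.mk γ)) =
      (kerEquiv hρ hcard).symm (op g) :=
  have := hρ.simplyConnected
  monodromyHom_eq hcard _ γ Γ hΓ h

theorem exists_lift_holonomy {p : P} (q : S.Q) (hq : S.spinorMap q = p) (γ : Path p p) :
    ∃ Γ : C(unitInterval, S.Q), (∀ t, S.spinorMap (Γ t) = γ t) ∧ Γ 0 = q ∧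
      Γ 1 = (kerEquiv hρ hcard (S.holonomy hπ hρ hcard p
        (FundamentalGroup.fromPath (.mk γ)))).unop.1 • q :=
  have := hρ.simplyConnected
  exists_lift_monodromyHom hcard _ ⟨q, hq⟩ γ

theorem mem_imagePiOne_iff {p : P} {q : S.Q} (hq : S.spinorMap q = p)
    (γ : FundamentalGroup P p) :
    γ ∈ S.imagePiOne hq ↔ S.holonomy hπ hρ hcard p γ = 1 := by
  have := hρ.simplyConnected
  have hu := S.isQuotientCoveringMap hπ hρ hcard
  rw [holonomy, monodromyHom_independent hcard _ ⟨q, hq⟩]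
  exact mem_range_iff_monodromyHom_eq_one (hu := hu) ⟨q, hq⟩ γ

theorem holonomy_orbitPiOne (p : P) (a : FundamentalGroup G (1 : G)) :
    S.holonomy hπ hρ hcard p (hπ.orbitPiOne p a) = a :=
  have := hρ.simplyConnected
  monodromyHom_orbit hcard S.isPrincipalBundle.continuous_action S.spinorMap_smul _ _ a

variable {S S'}

/-- An equivalence carries lifts to lifts and, being equivariant, preserves their displacements. -/
theorem Equivalent.holonomy_eq (h : S.Equivalent S') (p : P) :
    S.holonomy hπ hρ hcard p = S'.holonomy hπ hρ hcard p := by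
  obtain ⟨a, ha, -, hsmul, hu⟩ := h
  ext γ
  induction γ using Path.Homotopic.Quotient.ind with | _ γ =>
  obtain ⟨q, hq⟩ := (S.isQuotientCoveringMap hπ hρ hcard).surjective p
  obtain ⟨Γ, hΓ, h₀, h₁⟩ := S.exists_lift_holonomy hπ hρ hcard q hq γ
  refine Eq.symm ((S'.holonomy_eq hπ hρ hcard γ ⟨fun t => a (Γ t), ha.continuous.comp Γ.continuous⟩
    (fun t => (hu _).trans (hΓ t)) (g := (kerEquiv hρ hcard (S.holonomy hπ hρ hcard p
        (FundamentalGroup.fromPath (.mk γ)))).unop) ?_).trans ?_)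
  · change a (Γ 1) = _ • a (Γ 0)
    rw [h₀, h₁]
    exact hsmul q (unop _)
  · rw [op_unop, MulEquiv.symm_apply_apply]

/-- Equal monodromies have equal kernels, so `u_*` and `u'_*` have the same image, and the lifting
criterion gives a map over `P`. The work that remains is its smoothness and equivariance. -/
theorem equivalent_of_holonomy_eq [PathConnectedSpace M] {p : P}
    (h : S.holonomy hπ hρ hcard p = S'.holonomy hπ hρ hcard p) : S.Equivalent S' := by
  have := hρ.simplyConnected
  have hu := S.isQuotientCoveringMap hπ hρ hcard
  have hu' := S'.isQuotientCoveringMap hπ hρ hcard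
  have : PathConnectedSpace S.Q := S.isPrincipalBundle.pathConnectedSpace
  have : LocallyPathConnectedSpace S.Q := ChartedSpace.locallyPathConnectedSpace EP S.Q
  obtain ⟨q, rfl⟩ := hu.surjective p
  obtain ⟨q', hq'⟩ := hu'.surjective (S.spinorMap q)
  obtain ⟨F, ⟨hFq, hF⟩, -⟩ := hu'.isCoveringMap.existsUnique_continuousMap_lifts_of_range_le
    (f := (⟨S.spinorMap, hu.continuous⟩ : C(S.Q, P))) (a₀ := q) (e₀ := q') hq' (by
      intro γ hγ
      have h₁ : γ ∈ S.imagePiOne (rfl : S.spinorMap q = _) := by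
        obtain ⟨δ, rfl⟩ := hγ
        exact ⟨δ, by
          rw [FundamentalGroup.mapOfEq_apply, Path.Homotopic.Quotient.cast_rfl_rfl,
            FundamentalGroup.map_apply]⟩
      have h₂ : γ ∈ S'.imagePiOne hq' := by
        rw [mem_imagePiOne_iff hπ hρ hcard] at h₁ ⊢
        rwa [← h]
      exact h₂)
  have hF' (x : S.Q) : S'.spinorMap (F x) = S.spinorMap x := congrFun hF x
  refine ⟨F, fun x => ?_, fun x => ?_, fun x g => ?_, hF'⟩
  -- Near `x` both `F` and the smooth map `v ∘ u` are continuous lifts of `u` lying in a set where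
  -- `u'` is injective, so they coincide.
  · obtain ⟨v, W, hW, hxW, hv, hvx, huv⟩ := S'.isSpinorMap.exists_local_inverse hπ hρ (F x)
    obtain ⟨f, hfx, hf⟩ := hu'.isCoveringMap.isLocalHomeomorph (F x)
    rw [hF'] at hxW hvx
    have hvu : ContMDiffAt 𝓘(ℝ, EP) 𝓘(ℝ, EP) ∞ (fun y => v (S.spinorMap y)) x :=
      (hv.contMDiffAt (hW.mem_nhds hxW)).comp x S.contMDiff_spinorMap.contMDiffAt
    refine hvu.congr_of_eventuallyEq ?_
    have h₁ : ∀ᶠ y in 𝓝 x, v (S.spinorMap y) ∈ f.source :=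
      hvu.continuousAt.eventually_mem (f.open_source.mem_nhds (hvx.symm ▸ hfx))
    filter_upwards [F.continuous.continuousAt.eventually_mem (f.open_source.mem_nhds hfx), h₁,
      hu.continuous.continuousAt.eventually_mem (hW.mem_nhds hxW)] with y hy hy' hyW
    refine f.injOn hy hy' ?_
    rw [← hf, hF', huv _ hyW]
  · rw [← S'.proj_spinorMap, hF', S.proj_spinorMap]
  -- Both sides, as functions of `g`, lift the same map from the connected group `Gt` and agree at
  -- 1.
  · have hc : Continuous fun g : Gt => F (op g • x) := F.continuous.comp
      (S.isPrincipalBundle.continuous_action.comp (Continuous.prodMk_right x))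
    have hc' : Continuous fun g : Gt => op g • F x :=
      S'.isPrincipalBundle.continuous_action.comp (Continuous.prodMk_right (F x))
    refine congrFun (hu'.isCoveringMap.eq_of_comp_eq hc hc' (funext fun g => ?_) 1 (by simp)) g
    simp only [Function.comp_apply, hF', S.spinorMap_smul, S'.spinorMap_smul]

end SpinorStructure

end Holonomy

end SpinorClassification

namespace SpinorClassification

open MulOpposite Topology

/-! ### The difference of two spinor structures. -/

section Difference

variable {H Q Q' : Type*} [Group H] [MulAction Hᵐᵒᵖ Q] [MulAction Hᵐᵒᵖ Q']

/-- The pairs `(q, q')` and `(r, r')` in a product of two spaces with a right action differ by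
`k` if `r = q · a` and `r' = q' · k · a` for some `a`. -/
def PairDiff (q : Q) (q' : Q') (r : Q) (r' : Q') (k : H) : Prop :=
  ∃ a : H, op a • q = r ∧ op (k * a) • q' = r'

theorem PairDiff.trans {q r s : Q} {q' r' s' : Q'} {k l : H} (h : PairDiff q q' r r' k)
    (h' : PairDiff r r' s s' l) (hl : ∀ g : H, g * l = l * g) : PairDiff q q' s s' (k * l) := by
  obtain ⟨a, rfl, rfl⟩ := h
  obtain ⟨b, rfl, rfl⟩ := h'
  refine ⟨a * b, by rw [op_mul, mul_smul], ?_⟩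
  rw [← mul_smul, ← op_mul, mul_assoc, mul_assoc, ← mul_assoc a, hl, mul_assoc]

end Difference

section DifferenceCovering

universe v w

variable {EM EG EP : Type*}
  [NormedAddCommGroup EM] [NormedSpace ℝ EM] [NormedAddCommGroup EG] [NormedSpace ℝ EG]
  [NormedAddCommGroup EP] [NormedSpace ℝ EP]
  {M : Type v} [TopologicalSpace M] [ChartedSpace EM M]
  {G : Type*} [TopologicalSpace G] [ChartedSpace EG G] [Group G]
  {Gt : Type w} [TopologicalSpace Gt] [ChartedSpace EG Gt] [Group Gt]
  {P : Type u} [TopologicalSpace P] [ChartedSpace EP P] [MulAction Gᵐᵒᵖ P]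
  {π : P → M} {ρ : Gt →* G}

theorem IsPrincipalBundle.pairDiff_unique {Q Q' : Type*} [TopologicalSpace Q]
    [ChartedSpace EP Q] [MulAction Gtᵐᵒᵖ Q] [TopologicalSpace Q'] [ChartedSpace EP Q']
    [MulAction Gtᵐᵒᵖ Q'] {pr : Q → M} {pr' : Q' → M} (h : IsPrincipalBundle EM EG EP Gt pr)
    (h' : IsPrincipalBundle EM EG EP Gt pr') {q r : Q} {q' r' : Q'} {k l : Gt}
    (hk : PairDiff q q' r r' k) (hl : PairDiff q q' r r' l) : k = l := by
  obtain ⟨a, rfl, rfl⟩ := hk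
  obtain ⟨b, hb, hb'⟩ := hl
  obtain rfl := h.eq_of_smul_eq hb
  exact (mul_right_cancel (h'.eq_of_smul_eq hb')).symm

theorem IsPrincipalBundle.continuousOn_pairDiff [IsTopologicalGroup Gt] {Q Q' : Type*}
    [TopologicalSpace Q] [ChartedSpace EP Q] [MulAction Gtᵐᵒᵖ Q] [TopologicalSpace Q']
    [ChartedSpace EP Q'] [MulAction Gtᵐᵒᵖ Q'] {pr : Q → M} {pr' : Q' → M}
    (h : IsPrincipalBundle EM EG EP Gt pr) (h' : IsPrincipalBundle EM EG EP Gt pr')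
    {T : Type*} [TopologicalSpace T] {s : Set T} {f g : T → Q} {f' g' : T → Q'} {k : T → Gt}
    (hf : ContinuousOn f s) (hf' : ContinuousOn f' s) (hg : ContinuousOn g s)
    (hg' : ContinuousOn g' s) (hk : ∀ t ∈ s, PairDiff (f t) (f' t) (g t) (g' t) (k t)) :
    ContinuousOn k s := by
  classical
  choose! a ha ha' using hk
  have h₁ : ContinuousOn a s := h.continuousOn_of_smul_eq hf hg ha
  have h₂ : ContinuousOn (fun t => k t * a t) s := h'.continuousOn_of_smul_eq hf' hg' ha'
  exact (h₂.mul h₁.inv).congr fun t _ => (mul_inv_cancel_right _ _).symm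

namespace SpinorStructure

theorem exists_pairDiff (hπ : IsPrincipalBundle EM EG EP G π)
    (S₀ S : SpinorStructure EM EG (EP := EP) π ρ) {q₀ r₀ : S₀.Q} {q r : S.Q}
    (hq : S₀.spinorMap q₀ = S.spinorMap q) (hr : S₀.spinorMap r₀ = S.spinorMap r)
    (h : S₀.proj q₀ = S₀.proj r₀) : ∃ k : ρ.ker, PairDiff q₀ q r₀ r k.1 := by
  obtain ⟨a, rfl⟩ := (S₀.isPrincipalBundle.proj_eq_iff q₀ r₀).1 h
  obtain ⟨b, rfl⟩ := (S.isPrincipalBundle.proj_eq_iff q r).1 (by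
    rw [← S.proj_spinorMap, ← S.proj_spinorMap, ← hq, ← hr, S₀.proj_spinorMap,
      S₀.proj_spinorMap, h])
  rw [S₀.spinorMap_smul, S.spinorMap_smul, hq] at hr
  refine ⟨⟨b * a⁻¹, ?_⟩, a, rfl, by rw [inv_mul_cancel_right]⟩
  rw [MonoidHom.mem_ker, map_mul, map_inv, mul_inv_eq_one]
  exact (hπ.eq_of_smul_eq hr).symm

variable [LieGroup 𝓘(ℝ, EG) ∞ G] [FiniteDimensional ℝ EP]

theorem exists_local_sections (hπ : IsPrincipalBundle EM EG EP G π)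
    (hρ : IsUniversalCoveringGroup EG ρ) (hcard : Nat.card ρ.ker = 2)
    (S₀ S : SpinorStructure EM EG (EP := EP) π ρ) (m : M) :
    ∃ (U : Set M) (s₀ : M → S₀.Q) (s : M → S.Q), IsOpen U ∧ m ∈ U ∧ ContinuousOn s₀ U ∧
      ContinuousOn s U ∧ ∀ x ∈ U, S₀.proj (s₀ x) = x ∧ S₀.spinorMap (s₀ x) = S.spinorMap (s x) := by
  obtain ⟨e, he, -⟩ := S₀.isPrincipalBundle.exists_trivialization m
  set s₀ : M → S₀.Q := fun x => e.toOpenPartialHomeomorph.symm (x, 1) with hs₀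
  have hc : ContinuousOn s₀ e.baseSet := e.continuousOn_symm_prodMk_left
  have hu := S.isQuotientCoveringMap hπ hρ hcard
  have hu₀ : Continuous S₀.spinorMap := S₀.contMDiff_spinorMap.continuous
  obtain ⟨q, hq⟩ := hu.surjective (S₀.spinorMap (s₀ m))
  obtain ⟨f, hfq, hf⟩ := hu.isCoveringMap.isLocalHomeomorph q
  have hc' : ContinuousOn (fun x => S₀.spinorMap (s₀ x)) e.baseSet := hu₀.comp_continuousOn hc
  refine ⟨e.baseSet ∩ (fun x => S₀.spinorMap (s₀ x)) ⁻¹' f.target, s₀,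
    fun x => f.symm (S₀.spinorMap (s₀ x)), hc'.isOpen_inter_preimage e.open_baseSet f.open_target,
    ⟨he, ?_⟩, hc.mono Set.inter_subset_left, ?_, fun x hx => ⟨e.proj_symm_apply' hx.1, ?_⟩⟩
  · rw [Set.mem_preimage, ← hq, hf]
    exact f.map_source hfq
  · exact f.continuousOn_symm.comp (hc'.mono Set.inter_subset_left) fun x hx => hx.2
  · rw [hf, f.right_inv hx.2]

/-- `D` plays the role of the quotient of `Q₀ ×_P Q` by the diagonal action of `Gt`, and `F` that of
the quotient map. It is glued from pieces with discrete fibre ker ρ, each given by a pair of local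
sections with the same image in `P`. -/
theorem exists_difference_covering [LieGroup 𝓘(ℝ, EG) ∞ Gt] [T2Space Gt]
    (hπ : IsPrincipalBundle EM EG EP G π)
    (hρ : IsUniversalCoveringGroup EG ρ) (hcard : Nat.card ρ.ker = 2)
    (S₀ S : SpinorStructure EM EG (EP := EP) π ρ) :
    ∃ (D : Type (max v w)) (_ : TopologicalSpace D) (pr : D → M) (F : S₀.Q → S.Q → D),
      IsCoveringMap pr ∧ (∀ q₀ q, pr (F q₀ q) = S₀.proj q₀) ∧
      (∀ (f₀ : C(unitInterval, S₀.Q)) (f : C(unitInterval, S.Q)),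
        (∀ t, S₀.spinorMap (f₀ t) = S.spinorMap (f t)) → Continuous fun t => F (f₀ t) (f t)) ∧
      ∀ q₀ q, S₀.spinorMap q₀ = S.spinorMap q → ∀ g₀ g : Gt, ρ g₀ = ρ g →
        F (op g₀ • q₀) (op g • q) = F q₀ q → g₀ = g := by
  have : Finite ρ.ker := Nat.finite_of_card_ne_zero (by rw [hcard]; exact two_ne_zero)
  have : IsTopologicalGroup Gt := topologicalGroup_of_lieGroup 𝓘(ℝ, EG) ∞
  have hcomm (k : ρ.ker) (g : Gt) : g * k.1 = k.1 * g :=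
    commute_of_mem_of_card_eq_two hcard k.2 g
  choose U s₀ s hUo hmU hs₀ hs hsec using S₀.exists_local_sections hπ hρ hcard S
  have huniq {q₀ r₀ : S₀.Q} {q r : S.Q} {k l : ρ.ker} (hk : PairDiff q₀ q r₀ r k.1)
      (hl : PairDiff q₀ q r₀ r l.1) : k = l :=
    Subtype.ext (S₀.isPrincipalBundle.pairDiff_unique S.isPrincipalBundle hk hl)
  -- The transition function between two section pairs, with default value 1 off the overlap.
  have hc (i j x : M) : ∃ k : ρ.ker, x ∈ U i ∩ U j →
      PairDiff (s₀ i x) (s i x) (s₀ j x) (s j x) k.1 := by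
    by_cases hx : x ∈ U i ∩ U j
    · obtain ⟨k, hk⟩ := S₀.exists_pairDiff hπ S (hsec i x hx.1).2 (hsec j x hx.2).2
        ((hsec i x hx.1).1.trans (hsec j x hx.2).1.symm)
      exact ⟨k, fun _ => hk⟩
    · exact ⟨1, fun h => absurd h hx⟩
  choose c hc using hc
  have hv (q₀ : S₀.Q) (q : S.Q) : ∃ k : ρ.ker, S₀.spinorMap q₀ = S.spinorMap q →
      PairDiff (s₀ (S₀.proj q₀) (S₀.proj q₀)) (s (S₀.proj q₀) (S₀.proj q₀)) q₀ q k.1 := by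
    by_cases hq : S₀.spinorMap q₀ = S.spinorMap q
    · have := hsec _ _ (hmU (S₀.proj q₀))
      obtain ⟨k, hk⟩ := S₀.exists_pairDiff hπ S this.2 hq this.1
      exact ⟨k, fun _ => hk⟩
    · exact ⟨1, fun h => absurd h hq⟩
  choose v hv using hv
  have hc_comp {i j k x : M} (hx : x ∈ U i ∩ U j ∩ U k) : c i j x * c j k x = c i k x :=
    huniq ((hc i j x hx.1).trans (hc j k x ⟨hx.1.2, hx.2⟩) (hcomm _)) (hc i k x ⟨hx.1.1, hx.2⟩)
  have hc_self {i x : M} (hx : x ∈ U i) : c i i x = 1 := by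
    have h := hc_comp (i := i) (j := i) (k := i) ⟨⟨hx, hx⟩, hx⟩
    rwa [mul_eq_left] at h
  have hc_cont (i j : M) : ContinuousOn (c i j) (U i ∩ U j) := by
    rw [IsEmbedding.subtypeVal.isInducing.continuousOn_iff]
    exact S₀.isPrincipalBundle.continuousOn_pairDiff S.isPrincipalBundle
      ((hs₀ i).mono Set.inter_subset_left) ((hs i).mono Set.inter_subset_left)
      ((hs₀ j).mono Set.inter_subset_right) ((hs j).mono Set.inter_subset_right)
      fun x hx => hc i j x hx
  -- If a pair has coordinates `kᵢ` and `kⱼ`, then `kᵢ = c i j x * kⱼ`; the inverse in `coordChange`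
  -- comes from solving for `kⱼ`.
  let Z : FiberBundleCore M M ρ.ker :=
    { baseSet := U
      isOpen_baseSet := hUo
      indexAt := id
      mem_baseSet_at := hmU
      coordChange := fun i j x k => (c i j x)⁻¹ * k
      coordChange_self := fun i x hx k => by
        rw [hc_self hx, inv_one, one_mul]
      continuousOn_coordChange := fun i j =>
        (((hc_cont i j).comp continuousOn_fst fun x hx => hx.1).inv).mul continuousOn_snd
      coordChange_comp := fun i j k x hx l => by
        rw [← mul_assoc, ← mul_inv_rev, hc_comp hx] }
  refine ⟨Z.TotalSpace, inferInstance, Z.proj, fun q₀ q => ⟨S₀.proj q₀, v q₀ q⟩,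
    FiberBundle.isCoveringMap (F := ρ.ker), fun _ _ => rfl, fun f₀ f hf => ?_, ?_⟩
  · rw [continuous_iff_continuousAt]
    intro t
    set i := S₀.proj (f₀ t) with hi
    have hpr : Continuous fun t => S₀.proj (f₀ t) :=
      S₀.isPrincipalBundle.continuous_proj.comp f₀.continuous
    have hU : IsOpen ((fun t => S₀.proj (f₀ t)) ⁻¹' U i) := (hUo i).preimage hpr
    refine (Z.localTriv i).continuousAt_of_comp_left hpr.continuousAt (hmU i) ?_
    change ContinuousAt (fun t => (S₀.proj (f₀ t), (c (S₀.proj (f₀ t)) i (S₀.proj (f₀ t)))⁻¹ *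
      v (f₀ t) (f t))) t
    refine hpr.continuousAt.prodMk (ContinuousOn.continuousAt ?_ (hU.mem_nhds (hmU i)))
    rw [IsEmbedding.subtypeVal.isInducing.continuousOn_iff]
    refine S₀.isPrincipalBundle.continuousOn_pairDiff S.isPrincipalBundle
      ((hs₀ i).comp hpr.continuousOn fun t ht => ht)
      ((hs i).comp hpr.continuousOn fun t ht => ht) f₀.continuous.continuousOn
      f.continuous.continuousOn fun t ht => ?_
    -- The coordinate `v` refers to the sections indexed by the moving base point. Composing with
    -- the transition function refers it to the fixed index `i`, where continuity can be checked.
    have h₁ := hc i (S₀.proj (f₀ t)) (S₀.proj (f₀ t)) ⟨ht, hmU _⟩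
    have h₂ := h₁.trans (hv _ _ (hf t)) (hcomm _)
    have h₃ : (c (S₀.proj (f₀ t)) i (S₀.proj (f₀ t)))⁻¹ =
        c i (S₀.proj (f₀ t)) (S₀.proj (f₀ t)) := by
      rw [inv_eq_iff_mul_eq_one, hc_comp ⟨⟨hmU _, ht⟩, hmU _⟩, hc_self (hmU _)]
    simpa only [Function.comp_apply, h₃, Subgroup.coe_mul] using h₂
  · intro q₀ q hq g₀ g hg h
    have hpr : S₀.proj (op g₀ • q₀) = S₀.proj q₀ := S₀.isPrincipalBundle.proj_smul _ _
    have hq' : S₀.spinorMap (op g₀ • q₀) = S.spinorMap (op g • q) := by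
      rw [S₀.spinorMap_smul, S.spinorMap_smul, hq, hg]
    have h₁ := hv _ _ hq
    have h₂ := hv _ _ hq'
    have h₃ : v (op g₀ • q₀) (op g • q) = v q₀ q :=
      congrArg (fun d : Z.TotalSpace => (d.2 : ρ.ker)) h
    rw [hpr, h₃] at h₂
    clear hpr hq' h h₃ hg
    generalize S₀.proj q₀ = m at h₁ h₂
    generalize v q₀ q = k at h₁ h₂
    obtain ⟨a, ha, ha'⟩ := h₁
    obtain ⟨b, hb, hb'⟩ := h₂
    rw [← ha, ← mul_smul, ← op_mul] at hb
    rw [← ha', ← mul_smul, ← op_mul] at hb'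
    have e₁ := S₀.isPrincipalBundle.eq_of_smul_eq hb
    have e₂ := S.isPrincipalBundle.eq_of_smul_eq hb'
    rw [e₁, mul_assoc, mul_right_inj, mul_right_inj] at e₂
    exact e₂

variable [LieGroup 𝓘(ℝ, EG) ∞ Gt] [T2Space Gt]
  (hπ : IsPrincipalBundle EM EG EP G π) (hρ : IsUniversalCoveringGroup EG ρ)
  (hcard : Nat.card ρ.ker = 2) (S₀ S : SpinorStructure EM EG (EP := EP) π ρ)

/-- The lifts of the loop to `Q₀` and `Q` give a path in `D` over its projection. That projection is
null-homotopic, so the path in `D` is closed, which forces equal displacements. -/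
theorem holonomy_eq_of_projPiOne_eq_one {p : P} {m : M} (hp : π p = m) {k : FundamentalGroup P p}
    (hk : hπ.projPiOne hp k = 1) :
    S₀.holonomy hπ hρ hcard p k = S.holonomy hπ hρ hcard p k := by
  subst hp
  obtain ⟨D, _, pr, F, hpr, hF, hFc, hFi⟩ := S₀.exists_difference_covering hπ hρ hcard S
  induction k using Path.Homotopic.Quotient.ind with | _ γ =>
  obtain ⟨q₀, hq₀⟩ := (S₀.isQuotientCoveringMap hπ hρ hcard).surjective p
  obtain ⟨q, hq⟩ := (S.isQuotientCoveringMap hπ hρ hcard).surjective p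
  obtain ⟨Γ₀, hΓ₀, h₀, h₀'⟩ := S₀.exists_lift_holonomy hπ hρ hcard q₀ hq₀ γ
  obtain ⟨Γ, hΓ, h, h'⟩ := S.exists_lift_holonomy hπ hρ hcard q hq γ
  let Λ : C(unitInterval, D) := ⟨fun t => F (Γ₀ t) (Γ t), hFc Γ₀ Γ fun t => by rw [hΓ₀, hΓ]⟩
  set δ : C(unitInterval, M) := ⟨fun t => π (γ t), hπ.continuous_proj.comp γ.continuous⟩ with hδ
  have hom : δ.HomotopicRel (.const _ (π p)) {0, 1} := by
    rw [IsPrincipalBundle.projPiOne, FundamentalGroup.mapOfEq_apply, FundamentalGroup.one_def] at hk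
    exact Path.Homotopic.Quotient.exact hk
  have hΛ : ∀ t, pr (Λ t) = π (γ t) := fun t => by
    rw [← hΓ₀, S₀.proj_spinorMap]; exact hF _ _
  have hz : π p = pr (Λ 0) := by rw [hΛ, γ.source]
  have e₁ : Λ = hpr.liftPath δ (Λ 0) (hΛ 0).symm := (hpr.eq_liftPath_iff' _).2 ⟨funext hΛ, rfl⟩
  have e₂ : Λ 1 = Λ 0 := by
    conv_lhs => rw [e₁]
    rw [hpr.liftPath_apply_one_eq_of_homotopicRel hom (Λ 0) _ hz]
    exact congrArg (fun f : C(unitInterval, D) => f 1) (hpr.liftPath_const hz)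
  change F (Γ₀ 1) (Γ 1) = F (Γ₀ 0) (Γ 0) at e₂
  rw [h₀, h, h₀', h'] at e₂
  have e₃ := hFi q₀ q (hq₀.trans hq.symm) _ _
    ((MonoidHom.mem_ker.1 (Subgroup.mem_op.1 (Subtype.property _))).trans
      (MonoidHom.mem_ker.1 (Subgroup.mem_op.1 (Subtype.property _))).symm) e₂
  exact (kerEquiv hρ hcard).injective (unop_injective (Subtype.ext (unop_injective e₃)))

/-- The homomorphism `π₁(M) → π₁(G)` which measures the difference of two spinor structures. -/
def difference [ContinuousMul G] [PathConnectedSpace G] {p : P} {m : M} (hp : π p = m) :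
    FundamentalGroup M m →* FundamentalGroup G (1 : G) :=
  (hπ.projPiOne hp).liftOfSurjective (hπ.projPiOne_surjective hp)
    ⟨(S.holonomy hπ hρ hcard p) / (S₀.holonomy hπ hρ hcard p), fun k hk => by
      rw [MonoidHom.mem_ker, MonoidHom.div_apply, div_eq_one,
        S₀.holonomy_eq_of_projPiOne_eq_one hπ hρ hcard S hp hk]⟩

theorem difference_projPiOne [ContinuousMul G] [PathConnectedSpace G] {p : P} {m : M} (hp : π p = m)
    (k : FundamentalGroup P p) :
    S₀.difference hπ hρ hcard S hp (hπ.projPiOne hp k) =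
      S.holonomy hπ hρ hcard p k / S₀.holonomy hπ hρ hcard p k :=
  (hπ.projPiOne hp).liftOfRightInverse_comp_apply _ _ _ k

end SpinorStructure

end DifferenceCovering

end SpinorClassification

namespace SpinorClassification

open MulOpposite Topology Filter

/-! ### Twisting a principal bundle by central, locally constant transition functions. -/

section Twist

/-- A family of neighbourhoods with functions to the centre of `H`, whose quotients are locally
constant on the intersections. -/
structure LocalGauge (M H : Type*) [TopologicalSpace M] [Group H] where
  /-- The neighbourhood of a point. -/
  nhd : M → Set M
  /-- The function on the neighbourhood. -/
  gauge : M → M → H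
  isOpen_nhd : ∀ i, IsOpen (nhd i)
  mem_nhd : ∀ i, i ∈ nhd i
  comm : ∀ i x g, gauge i x * g = g * gauge i x
  eventually_eq : ∀ i j x, x ∈ nhd i → x ∈ nhd j →
    ∀ᶠ y in 𝓝 x, (gauge i y)⁻¹ * gauge j y = (gauge i x)⁻¹ * gauge j x

variable {EM EG EP : Type*}
  [NormedAddCommGroup EM] [NormedSpace ℝ EM] [NormedAddCommGroup EG] [NormedSpace ℝ EG]
  [NormedAddCommGroup EP] [NormedSpace ℝ EP]
  {M : Type*} [TopologicalSpace M] [ChartedSpace EM M]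
  {H : Type*} [TopologicalSpace H] [ChartedSpace EG H] [Group H]
  {Q : Type u} [TopologicalSpace Q] [ChartedSpace EP Q] [MulAction Hᵐᵒᵖ Q]
  {pr : Q → M}

namespace LocalGauge

/-- The total space of the principal bundle which is obtained from `pr : Q → M` by twisting the
local trivialisations with a local gauge. As a set it is `Q`. -/
def Twist (_ : LocalGauge M H) (_ : IsPrincipalBundle EM EG EP H pr) : Type u := Q

variable (c : LocalGauge M H) (h : IsPrincipalBundle EM EG EP H pr)

/-- The projection of a twisted bundle. -/
def proj (q : c.Twist h) : M := pr q

instance : MulAction Hᵐᵒᵖ (c.Twist h) := inferInstanceAs (MulAction Hᵐᵒᵖ Q)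

/-- The identification of the twisted bundle with the original one over a neighbourhood. -/
def chart (i : M) : PartialEquiv (c.Twist h) Q where
  toFun q := op (c.gauge i (c.proj h q)) • (show Q from q)
  invFun q := op (c.gauge i (pr q))⁻¹ • q
  source := c.proj h ⁻¹' c.nhd i
  target := pr ⁻¹' c.nhd i
  map_source' q hq := by
    rw [Set.mem_preimage, h.proj_smul]
    exact hq
  map_target' q hq := by
    change pr (op (c.gauge i (pr q))⁻¹ • q) ∈ c.nhd i
    rw [h.proj_smul]
    exact hq
  left_inv' q hq := by
    rw [h.proj_smul, ← mul_smul, ← op_mul]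
    change op (c.gauge i (c.proj h q) * (c.gauge i (c.proj h q))⁻¹) • q = q
    rw [mul_inv_cancel, op_one, one_smul]
  right_inv' q hq := by
    change op (c.gauge i (pr (op (c.gauge i (pr q))⁻¹ • q))) • op (c.gauge i (pr q))⁻¹ • q = q
    rw [h.proj_smul, ← mul_smul, ← op_mul, inv_mul_cancel, op_one, one_smul]

theorem proj_chart (i : M) (q : c.Twist h) : pr (c.chart h i q) = c.proj h q :=
  h.proj_smul _ _

theorem proj_chart_symm (i : M) (q : Q) : c.proj h ((c.chart h i).symm q) = pr q :=
  h.proj_smul _ _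

/-- Equivariance is where centrality of the gauge is used. -/
theorem chart_smul (i : M) (q : c.Twist h) (g : H) :
    c.chart h i (op g • q) = op g • c.chart h i q := by
  have : c.proj h (op g • q) = c.proj h q := h.proj_smul _ _
  change op (c.gauge i (c.proj h (op g • q))) • op g • (show Q from q) =
    op g • op (c.gauge i (c.proj h q)) • (show Q from q)
  rw [this, ← mul_smul, ← mul_smul, ← op_mul, ← op_mul, c.comm]

theorem chart_symm_smul (i : M) (q : Q) (g : H) :
    (c.chart h i).symm (op g • q) = op g • (c.chart h i).symm q := by
  change op (c.gauge i (pr (op g • q)))⁻¹ • op g • q = op g • op (c.gauge i (pr q))⁻¹ • q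
  rw [h.proj_smul, ← mul_smul, ← mul_smul, ← op_mul, ← op_mul]
  exact congrArg (fun k => op k • q) (Commute.inv_right (c.comm i (pr q) g).symm)

theorem chart_trans_source (i j : M) :
    ((c.chart h i).symm.trans (c.chart h j)).source = pr ⁻¹' (c.nhd i ∩ c.nhd j) := by
  ext q
  change q ∈ pr ⁻¹' c.nhd i ∧ (c.chart h i).symm q ∈ c.proj h ⁻¹' c.nhd j ↔ _
  rw [Set.mem_preimage, Set.mem_preimage, proj_chart_symm]
  rfl

theorem chart_trans_apply (i j : M) (q : Q) :
    (c.chart h i).symm.trans (c.chart h j) q =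
      op ((c.gauge i (pr q))⁻¹ * c.gauge j (pr q)) • q := by
  change op (c.gauge j (c.proj h ((c.chart h i).symm q))) • op (c.gauge i (pr q))⁻¹ • q = _
  rw [proj_chart_symm, ← mul_smul, ← op_mul]

/-- Near each point the change of chart is the action of one constant group element, although the
gauges themselves need not be continuous. -/
theorem contMDiffOn_chart_trans (i j : M) :
    ContMDiffOn 𝓘(ℝ, EP) 𝓘(ℝ, EP) ∞ ((c.chart h i).symm.trans (c.chart h j))
      (pr ⁻¹' (c.nhd i ∩ c.nhd j)) := by
  intro q hq
  have hs : ContMDiff 𝓘(ℝ, EP) 𝓘(ℝ, EP) ∞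
      fun r : Q => op ((c.gauge i (pr q))⁻¹ * c.gauge j (pr q)) • r :=
    h.contMDiff_action.comp (contMDiff_id.prodMk contMDiff_const)
  refine (hs.contMDiffAt.congr_of_eventuallyEq ?_).contMDiffWithinAt
  filter_upwards [h.continuous_proj.continuousAt.eventually
    (c.eventually_eq i j (pr q) hq.1 hq.2)] with r hr
  rw [chart_trans_apply, hr]

/-- The identifications of the twisted bundle with the original one over small sets define the
topology of the twisted bundle. -/
def chartedSpaceCore : ChartedSpaceCore Q (c.Twist h) where
  atlas := Set.range (c.chart h)
  chartAt q := c.chart h (c.proj h q)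
  mem_chart_source _ := c.mem_nhd _
  chart_mem_atlas _ := ⟨_, rfl⟩
  open_source := by
    rintro _ _ ⟨i, rfl⟩ ⟨j, rfl⟩
    rw [chart_trans_source]
    exact ((c.isOpen_nhd i).inter (c.isOpen_nhd j)).preimage h.continuous_proj
  continuousOn_toFun := by
    rintro _ _ ⟨i, rfl⟩ ⟨j, rfl⟩
    rw [chart_trans_source]
    exact (c.contMDiffOn_chart_trans h i j).continuousOn

instance : TopologicalSpace (c.Twist h) := (c.chartedSpaceCore h).toTopologicalSpace

/-- The identification of the twisted bundle with the original one over a neighbourhood, as a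
homeomorphism. -/
def localHomeo (i : M) : OpenPartialHomeomorph (c.Twist h) Q :=
  (c.chartedSpaceCore h).openPartialHomeomorph (c.chart h i) ⟨i, rfl⟩

/-- The twisted bundle is locally homeomorphic to the original one. -/
@[reducible]
def chartedSpaceTwist : ChartedSpace Q (c.Twist h) where
  atlas := Set.range (c.localHomeo h)
  chartAt q := c.localHomeo h (c.proj h q)
  mem_chart_source _ := c.mem_nhd _
  chart_mem_atlas _ := ⟨_, rfl⟩

instance : ChartedSpace EP (c.Twist h) :=
  letI := c.chartedSpaceTwist h
  ChartedSpace.comp EP Q (c.Twist h)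

theorem mem_atlas_twist {e : OpenPartialHomeomorph (c.Twist h) EP} :
    e ∈ atlas EP (c.Twist h) ↔ ∃ i, ∃ f ∈ atlas EP Q, (c.localHomeo h i).trans f = e := by
  constructor
  · rintro ⟨_, ⟨i, rfl⟩, f, hf, rfl⟩
    exact ⟨i, f, hf, rfl⟩
  · rintro ⟨i, f, hf, rfl⟩
    exact ⟨_, ⟨i, rfl⟩, f, hf, rfl⟩

variable [IsManifold 𝓘(ℝ, EP) ∞ Q]

instance : IsManifold 𝓘(ℝ, EP) ∞ (c.Twist h) := by
  refine isManifold_of_contDiffOn _ _ _ fun e e' he he' => ?_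
  obtain ⟨i, f, hf, rfl⟩ := (c.mem_atlas_twist h).1 he
  obtain ⟨j, f', hf', rfl⟩ := (c.mem_atlas_twist h).1 he'
  have hs := contMDiffOn_symm_of_mem_maximalAtlas (I := 𝓘(ℝ, EP)) (n := ∞)
    (IsManifold.subset_maximalAtlas hf)
  have hs' := contMDiffOn_of_mem_maximalAtlas (I := 𝓘(ℝ, EP)) (n := ∞)
    (IsManifold.subset_maximalAtlas hf')
  have key : ContMDiffOn 𝓘(ℝ, EP) 𝓘(ℝ, EP) ∞
      (f' ∘ ((c.chart h i).symm.trans (c.chart h j)) ∘ f.symm)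
      (((c.localHomeo h i).trans f).symm.trans ((c.localHomeo h j).trans f')).source := by
    refine hs'.comp ((c.contMDiffOn_chart_trans h i j).comp (hs.mono ?_) ?_) ?_
    · exact fun x hx => hx.1.1
    · intro x hx
      refine ⟨hx.1.2, ?_⟩
      have : c.proj h ((c.chart h i).symm (f.symm x)) ∈ c.nhd j := hx.2.1
      rwa [proj_chart_symm] at this
    · exact fun x hx => hx.2.2
  rw [contMDiffOn_iff_contDiffOn] at key
  simpa using! key

theorem contMDiffOn_localHomeo (i : M) :
    ContMDiffOn 𝓘(ℝ, EP) 𝓘(ℝ, EP) ∞ (c.localHomeo h i) (c.localHomeo h i).source := by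
  intro q hq
  set f := chartAt EP (c.localHomeo h i q) with hf
  have hfm := chart_mem_atlas EP (c.localHomeo h i q)
  have hfs := mem_chart_source EP (c.localHomeo h i q)
  have hs := contMDiffOn_symm_of_mem_maximalAtlas (I := 𝓘(ℝ, EP)) (n := ∞)
    (IsManifold.subset_maximalAtlas hfm)
  have hs' := contMDiffOn_of_mem_maximalAtlas (I := 𝓘(ℝ, EP)) (n := ∞)
    (IsManifold.subset_maximalAtlas ((c.mem_atlas_twist h).2 ⟨i, f, hfm, rfl⟩))
  have hmem : q ∈ ((c.localHomeo h i).trans f).source := ⟨hq, hfs⟩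
  have key := (hs.comp hs' fun x hx => f.map_source hx.2).contMDiffAt
    (((c.localHomeo h i).trans f).open_source.mem_nhds hmem)
  refine (key.congr_of_eventuallyEq ?_).contMDiffWithinAt
  filter_upwards [((c.localHomeo h i).trans f).open_source.mem_nhds hmem] with x hx
  exact (f.left_inv hx.2).symm

theorem contMDiffOn_localHomeo_symm (i : M) :
    ContMDiffOn 𝓘(ℝ, EP) 𝓘(ℝ, EP) ∞ (c.localHomeo h i).symm (c.localHomeo h i).target := by
  intro q hq
  set f := chartAt EP q with hf
  have hfm := chart_mem_atlas EP q
  have hfs := mem_chart_source EP q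
  have hs := contMDiffOn_of_mem_maximalAtlas (I := 𝓘(ℝ, EP)) (n := ∞)
    (IsManifold.subset_maximalAtlas hfm)
  have hs' := contMDiffOn_symm_of_mem_maximalAtlas (I := 𝓘(ℝ, EP)) (n := ∞)
    (IsManifold.subset_maximalAtlas ((c.mem_atlas_twist h).2 ⟨i, f, hfm, rfl⟩))
  have hopen : IsOpen ((c.localHomeo h i).target ∩ f.source) :=
    (c.localHomeo h i).open_target.inter f.open_source
  have hmaps : Set.MapsTo f ((c.localHomeo h i).target ∩ f.source)
      ((c.localHomeo h i).trans f).target := fun x hx => ⟨f.map_source hx.2, by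
    change f.symm (f x) ∈ (c.localHomeo h i).target
    rw [f.left_inv hx.2]
    exact hx.1⟩
  have key := (hs'.comp (hs.mono Set.inter_subset_right) hmaps).contMDiffAt
    (hopen.mem_nhds ⟨hq, hfs⟩)
  refine (key.congr_of_eventuallyEq ?_).contMDiffWithinAt
  filter_upwards [hopen.mem_nhds ⟨hq, hfs⟩] with x hx
  exact congrArg _ (f.left_inv hx.2).symm

theorem contMDiff_proj : ContMDiff 𝓘(ℝ, EP) 𝓘(ℝ, EM) ∞ (c.proj h) := by
  intro q
  have hq : q ∈ (c.localHomeo h (c.proj h q)).source := c.mem_nhd _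
  have key := h.contMDiff_proj.contMDiffAt.comp q
    ((c.contMDiffOn_localHomeo h (c.proj h q)).contMDiffAt
      ((c.localHomeo h (c.proj h q)).open_source.mem_nhds hq))
  exact key.congr_of_eventuallyEq (.of_forall fun r => (c.proj_chart h _ r).symm)

/-- Points over the same base point lie in one chart domain, and other points are separated by the
projection. -/
theorem t2Space [T2Space M] [T2Space Q] : T2Space (c.Twist h) := by
  refine ⟨fun q r hqr => ?_⟩
  by_cases hpr : c.proj h q = c.proj h r
  · set e := c.localHomeo h (c.proj h q) with he
    have hq : q ∈ e.source := c.mem_nhd _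
    have hr : r ∈ e.source := by
      change c.proj h r ∈ c.nhd _
      rw [← hpr]
      exact c.mem_nhd _
    obtain ⟨u, v, hu, hv, hqu, hrv, huv⟩ := t2_separation fun h => hqr (e.injOn hq hr h)
    exact ⟨e.source ∩ e ⁻¹' u, e.source ∩ e ⁻¹' v, e.isOpen_inter_preimage hu,
      e.isOpen_inter_preimage hv, ⟨hq, hqu⟩, ⟨hr, hrv⟩,
      (huv.preimage e).mono Set.inter_subset_right Set.inter_subset_right⟩
  · exact separated_by_continuous (c.contMDiff_proj h).continuous hpr

theorem contMDiff_action : ContMDiff (𝓘(ℝ, EP).prod 𝓘(ℝ, EG)) 𝓘(ℝ, EP) ∞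
    (fun x : c.Twist h × H => op x.2 • x.1) := by
  intro x
  set e := c.localHomeo h (c.proj h x.1) with he
  have hx : x.1 ∈ e.source := c.mem_nhd _
  have hopen : IsOpen (e.source ×ˢ (Set.univ : Set H)) := e.open_source.prod isOpen_univ
  have h₁ : ContMDiffOn (𝓘(ℝ, EP).prod 𝓘(ℝ, EG)) 𝓘(ℝ, EP) ∞
      (fun y : c.Twist h × H => op y.2 • e y.1) (e.source ×ˢ Set.univ) :=
    h.contMDiff_action.comp_contMDiffOn
      (((c.contMDiffOn_localHomeo h _).comp contMDiffOn_fst fun y hy => hy.1).prodMk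
        contMDiffOn_snd)
  have h₂ := (c.contMDiffOn_localHomeo_symm h _).comp h₁ fun y hy => by
    change pr _ ∈ c.nhd _
    rw [h.proj_smul]
    exact e.map_source hy.1
  refine (h₂.contMDiffAt (hopen.mem_nhds ⟨hx, trivial⟩)).congr_of_eventuallyEq ?_
  filter_upwards [hopen.mem_nhds ⟨hx, trivial⟩] with y hy
  change _ = (c.chart h _).symm (op y.2 • c.chart h _ y.1)
  rw [chart_symm_smul, (c.chart h _).left_inv hy.1]

/-- A local trivialisation of the twisted bundle. -/
def trivialization (i : M) (e : Bundle.Trivialization H pr) :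
    Bundle.Trivialization H (c.proj h) where
  toOpenPartialHomeomorph := (c.localHomeo h i).trans e.toOpenPartialHomeomorph
  baseSet := c.nhd i ∩ e.baseSet
  open_baseSet := (c.isOpen_nhd i).inter e.open_baseSet
  source_eq := by
    ext q
    change c.proj h q ∈ c.nhd i ∧ c.chart h i q ∈ e.source ↔ _
    rw [e.mem_source, c.proj_chart h i q]
    rfl
  target_eq := by
    ext x
    change x ∈ e.target ∧ pr (e.toOpenPartialHomeomorph.symm x) ∈ c.nhd i ↔
      (x.1 ∈ c.nhd i ∧ x.1 ∈ e.baseSet) ∧ True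
    rw [and_true, and_comm, e.mem_target]
    refine and_congr_left fun hx => ?_
    rw [e.proj_symm_apply (e.mem_target.2 hx)]
  proj_toFun q hq := (e.coe_fst hq.2).trans (c.proj_chart h i q)

theorem isPrincipalBundle : IsPrincipalBundle EM EG EP H (c.proj h) where
  contMDiff_proj := c.contMDiff_proj h
  surjective_proj := h.surjective_proj
  contMDiff_action := c.contMDiff_action h
  -- The set, the action and the projection are those of `Q`; only the topology and the charts are
  -- new.
  proj_eq_iff := h.proj_eq_iff
  free := h.free
  exists_trivialization m := by
    obtain ⟨e, he, hs, hs', heq⟩ := h.exists_trivialization m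
    refine ⟨c.trivialization h m e, ⟨c.mem_nhd m, he⟩, ?_, ?_, fun q hq g => ?_⟩
    · exact hs.comp ((c.contMDiffOn_localHomeo h m).mono fun q hq => hq.1) fun q hq => hq.2
    · exact (c.contMDiffOn_localHomeo_symm h m).comp (hs'.mono fun q hq => hq.1) fun q hq => hq.2
    · change (e (c.chart h m (op g • q))).2 = (e (c.chart h m q)).2 * g
      rw [chart_smul]
      exact heq _ hq.2 g

end LocalGauge

end Twist

section SpinorTwist

variable {EM EG EP : Type*}
  [NormedAddCommGroup EM] [NormedSpace ℝ EM] [NormedAddCommGroup EG] [NormedSpace ℝ EG]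
  [NormedAddCommGroup EP] [NormedSpace ℝ EP]
  {M : Type*} [TopologicalSpace M] [ChartedSpace EM M]
  {G : Type*} [Group G] {Gt : Type*} [TopologicalSpace Gt] [ChartedSpace EG Gt] [Group Gt]
  {P : Type u} [TopologicalSpace P] [ChartedSpace EP P] [MulAction Gᵐᵒᵖ P]
  {π : P → M} {ρ : Gt →* G}

namespace LocalGauge

variable (c : LocalGauge M Gt) (S : SpinorStructure EM EG (EP := EP) π ρ)

/-- The spinor map of a twisted bundle. -/
def spinorMap (q : c.Twist S.isPrincipalBundle) : P := S.spinorMap q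

theorem spinorMap_chart (hc : ∀ i x, ρ (c.gauge i x) = 1) (i : M)
    (q : c.Twist S.isPrincipalBundle) :
    S.spinorMap (c.chart S.isPrincipalBundle i q) = c.spinorMap S q := by
  refine (S.spinorMap_smul _ _).trans ?_
  rw [hc, op_one, one_smul]
  rfl

/-- The gauge lies in ker ρ, so the charts do not change the spinor map and it stays smooth. -/
theorem isSpinorMap (hc : ∀ i x, ρ (c.gauge i x) = 1) :
    IsSpinorMap EM EG (EP := EP) π ρ (c.proj S.isPrincipalBundle) (c.spinorMap S) where
  isPrincipalBundle := c.isPrincipalBundle S.isPrincipalBundle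
  contMDiff q := by
    set e := c.localHomeo S.isPrincipalBundle (c.proj S.isPrincipalBundle q)
    have hq : q ∈ e.source := c.mem_nhd _
    exact (S.contMDiff_spinorMap.contMDiffAt.comp q
      ((c.contMDiffOn_localHomeo S.isPrincipalBundle _).contMDiffAt
        (e.open_source.mem_nhds hq))).congr_of_eventuallyEq
      (.of_forall fun r => (c.spinorMap_chart S hc _ r).symm)
  proj_apply := S.proj_spinorMap
  map_smul := S.spinorMap_smul

/-- The spinor structure which is obtained from a spinor structure by twisting the local
trivialisations with a local gauge with values in the kernel of the universal covering. -/
def spinorTwist [TopologicalSpace G] [ChartedSpace EG G] [LieGroup 𝓘(ℝ, EG) ∞ G]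
    [FiniteDimensional ℝ EP] [T2Space M] [ParacompactSpace P] [Finite ρ.ker]
    (hπ : IsPrincipalBundle EM EG EP G π) (hρ : IsUniversalCoveringGroup EG ρ)
    (hc : ∀ i x, ρ (c.gauge i x) = 1) : SpinorStructure EM EG (EP := EP) π ρ where
  Q := c.Twist S.isPrincipalBundle
  t2Space := c.t2Space _
  paracompactSpace :=
    have := c.t2Space S.isPrincipalBundle
    have : Finite ρ.ker.op := Finite.of_equiv _ ρ.ker.equivOp
    ((c.isSpinorMap S hc).isQuotientCoveringMap hπ hρ).paracompactSpace
  proj := c.proj _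
  isPrincipalBundle := c.isPrincipalBundle _
  spinorMap := c.spinorMap S
  contMDiff_spinorMap := (c.isSpinorMap S hc).contMDiff
  proj_spinorMap := (c.isSpinorMap S hc).proj_apply
  spinorMap_smul := (c.isSpinorMap S hc).map_smul

end LocalGauge

end SpinorTwist

end SpinorClassification

namespace SpinorClassification

open MulOpposite Topology Filter

/-! ### Spinor structures with prescribed monodromy. -/

section Gauge

theorem transport_refl {X B : Type*} [TopologicalSpace X] [CommGroup B] {x₀ : X}
    [PathConnectedSpace X] (φ : FundamentalGroup X x₀ →* B) (x : X) :
    transport φ x x (.refl x) = 1 := by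
  have h := transport_trans φ (.refl x) (.refl x)
  rwa [Path.Homotopic.Quotient.refl_trans, eq_comm, mul_eq_left] at h

/-- The neighbourhood is a coordinate ball, which is contractible. -/
theorem exists_nhd_paths_homotopic (EM : Type*) [NormedAddCommGroup EM] [NormedSpace ℝ EM]
    {M : Type*} [TopologicalSpace M] [ChartedSpace EM M]
    (i : M) : ∃ U : Set M, IsOpen U ∧ i ∈ U ∧
    (∀ x ∈ U, ∃ γ : Path i x, ∀ t, γ t ∈ U) ∧
    ∀ {x y : M} (γ γ' : Path x y), (∀ t, γ t ∈ U) → (∀ t, γ' t ∈ U) → γ.Homotopic γ' := by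
  set e := chartAt EM i with he
  obtain ⟨r, hr, hball⟩ := Metric.isOpen_iff.1 e.open_target (e i)
    (e.map_source (mem_chart_source EM i))
  set f := e.symm.restrOpen (Metric.ball (e i) r) Metric.isOpen_ball with hf
  have hfs : f.source = Metric.ball (e i) r := by
    rw [hf, OpenPartialHomeomorph.restrOpen_source]
    exact Set.inter_eq_right.2 hball
  have hi : i ∈ f.target := by
    have h : e i ∈ f.source := by rw [hfs]; exact Metric.mem_ball_self hr
    have := f.map_source h
    rwa [show f (e i) = i from e.left_inv (mem_chart_source EM i)] at this
  have : ContractibleSpace f.source := by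
    rw [hfs]
    exact Metric.contractibleSpace_ball hr
  have : ContractibleSpace f.target := f.toHomeomorphSourceTarget.symm.contractibleSpace
  refine ⟨f.target, f.open_target, hi, fun x hx => ?_, fun {x y} γ γ' hγ hγ' => ?_⟩
  · exact ⟨(PathConnectedSpace.somePath (⟨i, hi⟩ : f.target) ⟨x, hx⟩).map continuous_subtype_val,
      fun t => Subtype.property _⟩
  · have hx : x ∈ f.target := by simpa using hγ 0
    have hy : y ∈ f.target := by simpa using hγ 1
    let δ : Path (⟨x, hx⟩ : f.target) ⟨y, hy⟩ :=
      ⟨⟨fun t => ⟨γ t, hγ t⟩, by fun_prop⟩, Subtype.ext γ.source, Subtype.ext γ.target⟩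
    let δ' : Path (⟨x, hx⟩ : f.target) ⟨y, hy⟩ :=
      ⟨⟨fun t => ⟨γ' t, hγ' t⟩, by fun_prop⟩, Subtype.ext γ'.source, Subtype.ext γ'.target⟩
    exact (SimplyConnectedSpace.paths_homotopic δ δ').map ⟨_, continuous_subtype_val⟩

/-- The gauge at `x` is the transport from the centre `i` along a path inside the ball, so it is
independent of that path. Along a small path all gauges change by the same factor, hence their
quotients are locally constant. -/
theorem exists_localGauge (EM : Type*) [NormedAddCommGroup EM] [NormedSpace ℝ EM]
    {M : Type*} [TopologicalSpace M] [ChartedSpace EM M]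
    {B H : Type*} [CommGroup B] [Group H] [PathConnectedSpace M] {m₀ : M}
    (φ : FundamentalGroup M m₀ →* B) (κ : B →* H) (hκ : ∀ b g, κ b * g = g * κ b) :
    ∃ c : LocalGauge M H, (∀ i x, c.gauge i x ∈ κ.range) ∧
      ∀ i {x y : M} (δ : Path x y), (∀ t, δ t ∈ c.nhd i) →
        c.gauge i y = c.gauge i x * κ (transport φ x y (.mk δ)) := by
  have : LocallyPathConnectedSpace M := ChartedSpace.locallyPathConnectedSpace EM M
  choose U hUo hU hUp hUh using exists_nhd_paths_homotopic EM (M := M)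
  have hex (i x : M) : ∃ γ : Path i x, x ∈ U i → ∀ t, γ t ∈ U i := by
    by_cases hx : x ∈ U i
    · obtain ⟨γ, hγ⟩ := hUp i x hx
      exact ⟨γ, fun _ => hγ⟩
    · exact ⟨PathConnectedSpace.somePath i x, fun h => absurd h hx⟩
  choose γ hγ using hex
  set ε : M → M → B := fun i x => transport φ i x (.mk (γ i x)) with hε
  have key (i : M) {x y : M} (δ : Path x y) (hδ : ∀ t, δ t ∈ U i) :
      ε i y = ε i x * transport φ x y (.mk δ) := by
    have hx : x ∈ U i := by simpa using hδ 0
    have hy : y ∈ U i := by simpa using hδ 1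
    change transport φ i y _ = transport φ i x _ * _
    rw [← transport_trans, ← Path.Homotopic.Quotient.mk_trans,
      Path.Homotopic.Quotient.eq.2 (hUh i (γ i y) ((γ i x).trans δ) (hγ i y hy) fun t => ?_)]
    rw [Path.trans_apply]
    split_ifs
    · exact hγ i x hx _
    · exact hδ _
  refine ⟨⟨U, fun i x => κ (ε i x), hUo, hU, fun i x g => hκ _ g, fun i j x hi hj => ?_⟩,
    fun i x => ⟨_, rfl⟩, fun i x y δ hδ => (congrArg κ (key i δ hδ)).trans (map_mul _ _ _)⟩
  obtain ⟨V, hV, hVU⟩ := (LocallyPathConnectedSpace.path_connected_basis x).mem_iff.1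
    (((hUo i).inter (hUo j)).mem_nhds ⟨hi, hj⟩)
  filter_upwards [hV.1] with y hy
  obtain ⟨δ, hδ⟩ := hV.2.joinedIn x (mem_of_mem_nhds hV.1) y hy
  rw [key i δ fun t => (hVU (hδ t)).1, key j δ fun t => (hVU (hδ t)).2, ← map_inv, ← map_inv,
    ← map_mul, ← map_mul]
  congr 1
  rw [mul_inv, mul_mul_mul_comm, inv_mul_cancel, mul_one]

/-- The inverse of the homomorphism along a path corrects a local gauge to a locally constant
function. -/
theorem exists_correction {M B H : Type*} [TopologicalSpace M] [CommGroup B] [Group H]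
    [PathConnectedSpace M] {m₀ : M}
    (φ : FundamentalGroup M m₀ →* B) (κ : B →* H) (hκ : ∀ b g, κ b * g = g * κ b)
    (c : LocalGauge M H)
    (hc : ∀ i {x y : M} (δ : Path x y), (∀ t, δ t ∈ c.nhd i) →
        c.gauge i y = c.gauge i x * κ (transport φ x y (.mk δ))) (γ : Path m₀ m₀) :
    ∃ θ : unitInterval → H, (∀ t, θ t ∈ κ.range) ∧ θ 0 = 1 ∧
      θ 1 = (κ (φ (FundamentalGroup.fromPath (.mk γ))))⁻¹ ∧
      ∀ t, ∀ᶠ s in 𝓝 t, θ s * c.gauge (γ t) (γ s) = θ t * c.gauge (γ t) (γ t) := by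
  have : ContractibleSpace unitInterval := (convex_Icc (0 : ℝ) 1).contractibleSpace ⟨0, by simp⟩
  have : LocallyPathConnectedSpace unitInterval := (convex_Icc (0 : ℝ) 1).locallyPathConnectedSpace
  -- The transport along the part of `γ` before `t`; any path from 0 to `t` in the contractible
  -- interval may be used.
  set f : unitInterval → B := fun t => transport φ (γ 0) (γ t)
    (.mk ((PathConnectedSpace.somePath 0 t).map γ.continuous)) with hf
  have hft {t s : unitInterval} (τ : Path t s) :
      f s = f t * transport φ (γ t) (γ s) (.mk (τ.map γ.continuous)) := by
    rw [hf, ← transport_trans, ← Path.Homotopic.Quotient.mk_trans, ← Path.map_trans]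
    refine congrArg _ (Path.Homotopic.Quotient.eq.2 ?_)
    exact (SimplyConnectedSpace.paths_homotopic (PathConnectedSpace.somePath 0 s)
      ((PathConnectedSpace.somePath 0 t).trans τ)).map ⟨γ, γ.continuous⟩
  have hf0 : f 0 = 1 := by
    have h := (SimplyConnectedSpace.paths_homotopic (PathConnectedSpace.somePath 0 0)
      (Path.refl (0 : unitInterval))).map (⟨γ, γ.continuous⟩ : C(unitInterval, M))
    exact (congrArg (transport φ _ _) (Path.Homotopic.Quotient.eq.2 h)).trans (transport_refl φ _)
  refine ⟨fun t => κ (f t)⁻¹, fun t => ⟨_, rfl⟩, by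
    change κ (f 0)⁻¹ = 1
    rw [hf0, inv_one, map_one], ?_, fun t => ?_⟩
  · rw [← map_inv, ← transport_loop, hf]
    refine congrArg (fun b => κ b⁻¹) ?_
    have h : (PathConnectedSpace.somePath (0 : unitInterval) 1).Homotopic ⟨.id _, rfl, rfl⟩ :=
      SimplyConnectedSpace.paths_homotopic _ _
    have h' := Path.Homotopic.Quotient.eq.2 (h.map (⟨γ, γ.continuous⟩ : C(unitInterval, M)))
    refine (congrArg (transport φ _ _) h').trans ?_
    exact apply_eq_of_forall_eq (transport φ) fun t => rfl
  · obtain ⟨V, hV, hVU⟩ := (LocallyPathConnectedSpace.path_connected_basis t).mem_iff.1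
      (((c.isOpen_nhd (γ t)).preimage γ.continuous).mem_nhds (c.mem_nhd (γ t)))
    filter_upwards [hV.1] with s hs
    obtain ⟨τ, hτ⟩ := hV.2.joinedIn t (mem_of_mem_nhds hV.1) s hs
    rw [hft τ, hc (γ t) (τ.map γ.continuous) fun r => hVU (hτ r), hκ, mul_assoc, ← map_mul,
      mul_inv, mul_comm, mul_assoc, inv_mul_cancel, mul_one, hκ]

end Gauge

section SpinorTwist

/-- In the chart at `i` the corrected map is locally `f` acted on by the constant `θ t * gauge i i`,
so it is continuous for the twisted topology. -/
theorem LocalGauge.continuous_smul {EM EG EP : Type*}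
    [NormedAddCommGroup EM] [NormedSpace ℝ EM] [NormedAddCommGroup EG] [NormedSpace ℝ EG]
    [NormedAddCommGroup EP] [NormedSpace ℝ EP]
    {M : Type*} [TopologicalSpace M] [ChartedSpace EM M]
    {H : Type*} [TopologicalSpace H] [ChartedSpace EG H] [Group H]
    {Q : Type u} [TopologicalSpace Q] [ChartedSpace EP Q] [MulAction Hᵐᵒᵖ Q]
    {pr : Q → M} (c : LocalGauge M H) (h : IsPrincipalBundle EM EG EP H pr)
    {T : Type*} [TopologicalSpace T] {f : T → Q} (hf : Continuous f) {θ : T → H}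
    (hθ : ∀ t, ∀ᶠ s in 𝓝 t, θ s * c.gauge (pr (f t)) (pr (f s)) =
      θ t * c.gauge (pr (f t)) (pr (f t))) :
    Continuous fun t => (show c.Twist h from op (θ t) • f t) := by
  rw [continuous_iff_continuousAt]
  intro t
  set i := pr (f t) with hi
  set k := θ t * c.gauge i i with hk
  have hg : ContinuousAt (fun s => op k • f s) t :=
    (h.continuous_action.comp (hf.prodMk continuous_const)).continuousAt
  have ht : op k • f t ∈ (c.localHomeo h i).target := by
    change pr _ ∈ c.nhd i
    rw [h.proj_smul]
    exact c.mem_nhd i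
  have key : ContinuousAt (fun s => (c.localHomeo h i).symm (op k • f s)) t :=
    ContinuousAt.comp (f := fun s => op k • f s)
      ((c.localHomeo h i).symm.continuousAt ht) hg
  refine key.congr ?_
  filter_upwards [hθ t, ((c.isOpen_nhd i).preimage (h.continuous_proj.comp hf)).mem_nhds
    (c.mem_nhd i)] with s hs hsU
  set q : c.Twist h := (show c.Twist h from op (θ s) • f s) with hq
  have hpr : c.proj h q = pr (f s) := h.proj_smul _ _
  have h₁ : c.chart h i q = op k • f s := by
    change op (c.gauge i (c.proj h q)) • op (θ s) • f s = op k • f s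
    rw [hpr, ← mul_smul, ← op_mul, hs]
  rw [← h₁]
  refine (c.chart h i).left_inv ?_
  change c.proj h q ∈ c.nhd i
  rw [hpr]
  exact hsU

variable {EM EG EP : Type*}
  [NormedAddCommGroup EM] [NormedSpace ℝ EM] [NormedAddCommGroup EG] [NormedSpace ℝ EG]
  [NormedAddCommGroup EP] [NormedSpace ℝ EP]
  {M : Type*} [TopologicalSpace M] [ChartedSpace EM M]
  {G : Type*} [TopologicalSpace G] [ChartedSpace EG G] [Group G]
  {Gt : Type*} [TopologicalSpace Gt] [ChartedSpace EG Gt] [Group Gt]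
  {P : Type u} [TopologicalSpace P] [ChartedSpace EP P] [MulAction Gᵐᵒᵖ P]
  {π : P → M} {ρ : Gt →* G} [LieGroup 𝓘(ℝ, EG) ∞ Gt] [T2Space Gt]

/-- The homomorphism from `π₁(G)` to the universal covering group, whose image is the kernel of the
covering. -/
def kerHom (hρ : IsUniversalCoveringGroup EG ρ) (hcard : Nat.card ρ.ker = 2) :
    FundamentalGroup G (1 : G) →* Gt where
  toFun a := unop (SpinorStructure.kerEquiv hρ hcard a).unop.1
  map_one' := by rw [map_one]; rfl
  map_mul' a b := by rw [map_mul]; rfl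

theorem map_kerHom (hρ : IsUniversalCoveringGroup EG ρ) (hcard : Nat.card ρ.ker = 2)
    (a : FundamentalGroup G (1 : G)) : ρ (kerHom hρ hcard a) = 1 :=
  (SpinorStructure.kerEquiv hρ hcard a).unop.2

/-- A lift `Γ` to the old bundle becomes a lift `Γ · θ` to the twisted one. The correction ends at
the inverse of φ on the projected loop, and this divides the displacement. -/
theorem SpinorStructure.exists_holonomy_eq [LieGroup 𝓘(ℝ, EG) ∞ G] [ContinuousMul G]
    [FiniteDimensional ℝ EP] [T2Space M] [ParacompactSpace P] [PathConnectedSpace M]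
    (hπ : IsPrincipalBundle EM EG EP G π)
    (hρ : IsUniversalCoveringGroup EG ρ) (hcard : Nat.card ρ.ker = 2)
    (S : SpinorStructure EM EG (EP := EP) π ρ) {p : P} {m : M} (hp : π p = m)
    (φ : FundamentalGroup M m →* FundamentalGroup G (1 : G)) :
    ∃ S' : SpinorStructure EM EG (EP := EP) π ρ, ∀ k,
      S'.holonomy hπ hρ hcard p k = S.holonomy hπ hρ hcard p k / φ (hπ.projPiOne hp k) := by
  subst hp
  have : Finite ρ.ker := Nat.finite_of_card_ne_zero (by rw [hcard]; exact two_ne_zero)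
  set κ := kerHom hρ hcard with hκ
  have hcomm (b : FundamentalGroup G (1 : G)) (g : Gt) : κ b * g = g * κ b :=
    (commute_of_mem_of_card_eq_two hcard (map_kerHom hρ hcard b) g).symm
  obtain ⟨c, hcκ, hc⟩ := exists_localGauge EM φ κ hcomm
  refine ⟨c.spinorTwist S hπ hρ fun i x => ?_, fun k => ?_⟩
  · obtain ⟨b, hb⟩ := hcκ i x
    rw [← hb, map_kerHom]
  induction k using Path.Homotopic.Quotient.ind with | _ γ =>
  obtain ⟨θ, hθκ, hθ₀, hθ₁, hθ⟩ := exists_correction φ κ hcomm c hc (γ.map hπ.continuous_proj)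
  obtain ⟨q, hq⟩ := (S.isQuotientCoveringMap hπ hρ hcard).surjective p
  obtain ⟨Γ, hΓ, h, h'⟩ := S.exists_lift_holonomy hπ hρ hcard q hq γ
  have hpr (t : unitInterval) : S.proj (Γ t) = π (γ t) := by rw [← S.proj_spinorMap, hΓ]
  have hcont := c.continuous_smul S.isPrincipalBundle Γ.continuous (θ := θ) fun t => by
    simp only [hpr]
    exact hθ t
  set a := S.holonomy hπ hρ hcard p (FundamentalGroup.fromPath (.mk γ)) with ha
  have hφ : φ (hπ.projPiOne rfl (FundamentalGroup.fromPath (.mk γ))) =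
      φ (FundamentalGroup.fromPath (.mk (γ.map hπ.continuous_proj))) := by
    rw [IsPrincipalBundle.projPiOne, FundamentalGroup.mapOfEq_apply]
    rfl
  set b := φ (FundamentalGroup.fromPath (.mk (γ.map hπ.continuous_proj))) with hb
  have hend := holonomy_eq hπ hρ hcard (c.spinorTwist S hπ hρ fun i x => by
      obtain ⟨b, hb⟩ := hcκ i x
      rw [← hb, map_kerHom]) γ ⟨_, hcont⟩ (fun t => ?_)
    (g := (kerEquiv hρ hcard b).unop⁻¹ * (kerEquiv hρ hcard a).unop) ?_
  · refine hend.trans ?_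
    rw [hφ, MulEquiv.symm_apply_eq, map_div, div_eq_mul_inv]
    rfl
  · obtain ⟨d, hd⟩ := hθκ t
    refine (S.spinorMap_smul _ _).trans ?_
    rw [← hd, map_kerHom, op_one, one_smul, hΓ]
  · change op (θ 1) • Γ 1 = (_ : Gtᵐᵒᵖ) • op (θ 0) • Γ 0
    rw [h', h, hθ₀, hθ₁, op_one, one_smul, ← mul_smul]
    rfl

end SpinorTwist

end SpinorClassification

namespace SpinorClassification

theorem card_fundamentalGroup {EG : Type*} [NormedAddCommGroup EG] [NormedSpace ℝ EG]
    {G : Type*} [TopologicalSpace G] [ChartedSpace EG G] [Group G]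
    {Gt : Type*} [TopologicalSpace Gt] [ChartedSpace EG Gt] [Group Gt] [LieGroup 𝓘(ℝ, EG) ∞ Gt]
    [T2Space Gt] {ρ : Gt →* G} (hρ : IsUniversalCoveringGroup EG ρ) (hcard : Nat.card ρ.ker = 2) :
    Nat.card (FundamentalGroup G (1 : G)) = 2 := by
  rw [Nat.card_congr (SpinorStructure.kerEquiv hρ hcard).toEquiv,
    Nat.card_congr (MulOpposite.opEquiv (α := ρ.ker.op)).symm, ← hcard]
  exact Nat.card_congr ρ.ker.equivOp.symm

/-! ### The classification and the image of the fundamental group. -/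

section Classification

variable {EM EG EP : Type*}
  [NormedAddCommGroup EM] [NormedSpace ℝ EM] [NormedAddCommGroup EG] [NormedSpace ℝ EG]
  [NormedAddCommGroup EP] [NormedSpace ℝ EP] [FiniteDimensional ℝ EP]
  {M : Type*} [TopologicalSpace M] [ChartedSpace EM M]
  {G : Type*} [TopologicalSpace G] [ChartedSpace EG G] [Group G] [LieGroup 𝓘(ℝ, EG) ∞ G]
  [ContinuousMul G]
  {Gt : Type*} [TopologicalSpace Gt] [ChartedSpace EG Gt] [Group Gt] [LieGroup 𝓘(ℝ, EG) ∞ Gt]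
  [T2Space Gt]
  {P : Type u} [TopologicalSpace P] [ChartedSpace EP P] [MulAction Gᵐᵒᵖ P]
  {π : P → M} {ρ : Gt →* G}
  (hπ : IsPrincipalBundle EM EG EP G π) (hρ : IsUniversalCoveringGroup EG ρ)
  (hcard : Nat.card ρ.ker = 2)

namespace SpinorStructure

variable (S₀ S S' : SpinorStructure EM EG (EP := EP) π ρ) [PathConnectedSpace G]
  {p : P} {m : M} (hp : π p = m)

theorem difference_self : S₀.difference hπ hρ hcard S₀ hp = 1 := by
  ext k
  obtain ⟨k, rfl⟩ := hπ.projPiOne_surjective hp k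
  rw [difference_projPiOne, div_self', MonoidHom.one_apply]

theorem difference_eq_iff [PathConnectedSpace M] :
    S₀.difference hπ hρ hcard S hp = S₀.difference hπ hρ hcard S' hp ↔ S.Equivalent S' := by
  constructor
  · intro h
    refine equivalent_of_holonomy_eq hπ hρ hcard (p := p) (MonoidHom.ext fun k => ?_)
    have hk := DFunLike.congr_fun h (hπ.projPiOne hp k)
    rwa [difference_projPiOne, difference_projPiOne, div_left_inj] at hk
  · intro h
    ext k
    obtain ⟨k, rfl⟩ := hπ.projPiOne_surjective hp k
    rw [difference_projPiOne, difference_projPiOne, h.holonomy_eq hπ hρ hcard]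

theorem exists_difference_eq [T2Space M] [ParacompactSpace P] [PathConnectedSpace M]
    (φ : FundamentalGroup M m →* FundamentalGroup G (1 : G)) :
    ∃ S : SpinorStructure EM EG (EP := EP) π ρ, S₀.difference hπ hρ hcard S hp = φ := by
  -- Twisting divides by the homomorphism, hence the inverse.
  obtain ⟨S, hS⟩ := S₀.exists_holonomy_eq hπ hρ hcard hp φ⁻¹
  refine ⟨S, MonoidHom.ext fun k => ?_⟩
  obtain ⟨k, rfl⟩ := hπ.projPiOne_surjective hp k
  rw [difference_projPiOne, hS, MonoidHom.inv_apply, div_inv_eq_mul, mul_div_cancel_left]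

/-- Both images are kernels of monodromies χ₀ and χ. On ker χ₀ the difference equals χ, and
multiplying `k` by `i_*(χ k)` changes χ by that same factor, whose square is 1. -/
theorem coe_imagePiOne {q₀ : S₀.Q} {q : S.Q} (hq₀ : S₀.spinorMap q₀ = p)
    (hq : S.spinorMap q = p) :
    (S.imagePiOne hq : Set (FundamentalGroup P p)) =
      {γ | ∃ k ∈ S₀.imagePiOne hq₀, γ = k * hπ.orbitPiOne p
        (S₀.difference hπ hρ hcard S hp (hπ.projPiOne hp k))} := by
  have hsq (a : FundamentalGroup G (1 : G)) : a * a = 1 := by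
    rw [← pow_two, ← card_fundamentalGroup hρ hcard]
    exact pow_card_eq_one'
  ext γ
  rw [SetLike.mem_coe, S.mem_imagePiOne_iff hπ hρ hcard, Set.mem_ofPred_eq]
  simp only [S₀.mem_imagePiOne_iff hπ hρ hcard, difference_projPiOne]
  constructor
  · intro h
    -- Removing `i_*(χ₀ γ)` brings `γ` into ker χ₀, because χ₀ ∘ i_* = id.
    refine ⟨γ * (hπ.orbitPiOne p (S₀.holonomy hπ hρ hcard p γ))⁻¹, ?_, ?_⟩
    · rw [map_mul, map_inv, holonomy_orbitPiOne, mul_inv_cancel]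
    · rw [map_mul, map_mul, map_inv, map_inv, holonomy_orbitPiOne, holonomy_orbitPiOne, h,
        mul_inv_cancel, one_mul, div_one, inv_eq_of_mul_eq_one_left (hsq _), inv_mul_cancel_right]
  · rintro ⟨k, hk, rfl⟩
    rw [map_mul, holonomy_orbitPiOne, hk, div_one, hsq]

end SpinorStructure

end Classification

end SpinorClassification

end

open SpinorClassification in
theorem mainTheorem11
    {EM : Type*} [NormedAddCommGroup EM] [NormedSpace ℝ EM] [FiniteDimensional ℝ EM]
    {M : Type*} [TopologicalSpace M] [ChartedSpace EM M] [IsManifold 𝓘(ℝ, EM) ∞ M]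
    [T2Space M] [ParacompactSpace M] [ConnectedSpace M] (m₀ : M)
    {EG : Type*} [NormedAddCommGroup EG] [NormedSpace ℝ EG] [FiniteDimensional ℝ EG]
    {G : Type*} [TopologicalSpace G] [ChartedSpace EG G] [Group G] [LieGroup 𝓘(ℝ, EG) ∞ G]
    [ContinuousMul G] [T2Space G] [ParacompactSpace G] [ConnectedSpace G] :
    -- evaluation on loops is a well-defined isomorphism `H¹(M; π₁(G)) ≃ Hom(π₁(M), π₁(G))`
    ∃ Ψ : SingularCohomology M (Additive (FundamentalGroup G (1 : G))) 1 ≃+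
        Additive (FundamentalGroup M m₀ →* FundamentalGroup G (1 : G)),
      IsEvaluation Ψ ∧ (∀ Ψ', IsEvaluation Ψ' → Ψ' = Ψ) ∧
      -- it is natural in `M`
      (∀ {N : Type*} [TopologicalSpace N] (n₀ : N) (f : C(M, N)) (hf : f m₀ = n₀)
        (ΨN : SingularCohomology N (Additive (FundamentalGroup G (1 : G))) 1 ≃+
          Additive (FundamentalGroup N n₀ →* FundamentalGroup G (1 : G))), IsEvaluation ΨN →
        ∀ x, (Ψ (cohomologyPullback f 1 x)).toMul =
          (ΨN x).toMul.comp (FundamentalGroup.mapOfEq f hf)) ∧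
      -- it is natural in `G`
      (∀ {G' : Type*} [TopologicalSpace G'] [Group G'] [ContinuousMul G'] (f : G →ₜ* G')
        (Ψ' : SingularCohomology M (Additive (FundamentalGroup G' (1 : G'))) 1 ≃+
          Additive (FundamentalGroup M m₀ →* FundamentalGroup G' (1 : G'))), IsEvaluation Ψ' →
        ∀ x, (Ψ' (cohomologyCoeff M
            (FundamentalGroup.mapOfEq (f : C(G, G')) (map_one f)).toAdditive 1 x)).toMul =
          (FundamentalGroup.mapOfEq (f : C(G, G')) (map_one f)).comp (Ψ x).toMul) ∧
      -- classification of the spinor structures when the universal cover of `G` is a double cover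
      (∀ {EP : Type*} [NormedAddCommGroup EP] [NormedSpace ℝ EP] [FiniteDimensional ℝ EP]
        {P : Type*} [TopologicalSpace P] [ChartedSpace EP P] [IsManifold 𝓘(ℝ, EP) ∞ P]
        [T2Space P] [ParacompactSpace P] [MulAction Gᵐᵒᵖ P]
        (π : P → M) (hπ : IsPrincipalBundle EM EG EP G π) (p₀ : P) (hp₀ : π p₀ = m₀)
        {Gt : Type*} [TopologicalSpace Gt] [ChartedSpace EG Gt] [Group Gt]
        [LieGroup 𝓘(ℝ, EG) ∞ Gt] [T2Space Gt] [ParacompactSpace Gt]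
        (ρ : Gt →* G), IsUniversalCoveringGroup EG ρ → Nat.card ρ.ker = 2 →
        ∃ ι : ZMod 2 ≃+ Additive (FundamentalGroup G (1 : G)),
        ∀ S₀ : SpinorStructure EM EG (EP := EP) π ρ,
        ∃ Θ : SpinorStructure EM EG (EP := EP) π ρ → SingularCohomology M (ZMod 2) 1,
          -- `Θ` induces a bijection from equivalence classes of spinor structures to `H¹(M; ℤ/2)`
          Function.Surjective Θ ∧ (∀ S S', Θ S = Θ S' ↔ S.Equivalent S') ∧ Θ S₀ = 0 ∧
          -- `S` is obtained from `S₀` by twisting with the homomorphism `π₁(M) → π₁(G)`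
          -- which corresponds to `Θ S`
          ∀ (S : SpinorStructure EM EG (EP := EP) π ρ) (q₀ : S₀.Q) (q : S.Q)
            (hq₀ : S₀.spinorMap q₀ = p₀) (hq : S.spinorMap q = p₀),
            (S.imagePiOne hq : Set (FundamentalGroup P p₀)) =
              {γ | ∃ k ∈ S₀.imagePiOne hq₀, γ = k * hπ.orbitPiOne p₀
                ((Ψ (cohomologyCoeff M ι.toAddMonoidHom 1 (Θ S))).toMul
                  (hπ.projPiOne hp₀ k))}) := by
  have : LocallyPathConnectedSpace M := ChartedSpace.locallyPathConnectedSpace EM M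
  have : PathConnectedSpace M := PathConnectedSpace.of_locallyPathConnectedSpace
  have : LocallyPathConnectedSpace G := ChartedSpace.locallyPathConnectedSpace EG G
  have : PathConnectedSpace G := PathConnectedSpace.of_locallyPathConnectedSpace
  obtain ⟨Ψ, hΨ⟩ := exists_isEvaluation (FundamentalGroup G (1 : G)) m₀
  refine ⟨Ψ, hΨ, fun Ψ' h' => hΨ.eq h', fun n₀ f hf ΨN hN x => hΨ.pullback hf hN x,
    fun f Ψ' h' x => hΨ.coeff _ h' x, ?_⟩
  intro EP _ _ _ P _ _ _ _ _ _ π hπ p₀ hp₀ Gt _ _ _ _ _ _ ρ hρ hcard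
  have hG : Nat.card (Additive (FundamentalGroup G (1 : G))) = 2 :=
    card_fundamentalGroup hρ hcard
  have : IsAddCyclic (Additive (FundamentalGroup G (1 : G))) :=
    have : Fact (Nat.Prime 2) := ⟨Nat.prime_two⟩
    isAddCyclic_of_prime_card hG
  refine ⟨(ZMod.ringEquivCongr hG.symm).toAddEquiv.trans (zmodAddCyclicAddEquiv this), fun S₀ => ?_⟩
  -- From here on it matters only that `ι` is an isomorphism.
  generalize (ZMod.ringEquivCongr hG.symm).toAddEquiv.trans (zmodAddCyclicAddEquiv this) = ι
  set e := (cohomologyCoeffEquiv (X := M) ι 1).toEquiv.trans Ψ.toEquiv with he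
  have hee (x) : e x = Ψ (cohomologyCoeff M ι.toAddMonoidHom 1 x) := rfl
  refine ⟨fun S => e.symm (.ofMul (S₀.difference hπ hρ hcard S hp₀)), fun x => ?_, fun S S' => ?_,
    ?_, fun S q₀ q hq₀ hq => ?_⟩
  · obtain ⟨S, hS⟩ := S₀.exists_difference_eq hπ hρ hcard hp₀ (e x).toMul
    exact ⟨S, (congrArg (fun φ => e.symm (.ofMul φ)) hS).trans (e.symm_apply_apply x)⟩
  · rw [e.symm.injective.eq_iff, Additive.ofMul.injective.eq_iff, SpinorStructure.difference_eq_iff]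
  · change e.symm (.ofMul (S₀.difference hπ hρ hcard S₀ hp₀)) = 0
    rw [S₀.difference_self, Equiv.symm_apply_eq, hee, map_zero, map_zero]
    rfl
  · rw [← hee, Equiv.apply_symm_apply]
    exact S₀.coe_imagePiOne hπ hρ hcard S hp₀ hq₀ hq
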